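/- Let $R$ be a (commutative) Dedekind domain with field of fractions $K$, and let $G$ be a finite group acting on $R$ by ring automorphisms $\sigma_g$; extend $\sigma_g$ to $K$. Let $A=K\diamondsuit_{\sigma,\alpha}G$ be a crystalline graded ring: a ring containing $K$ as a subring (with the same $1$, not necessarily central), with elements $u_g\neq 0$ ($g\in G$), $g\mapsto u_g$ injective, $u_e=1$, such that $A=\bigoplus_{g\in G}Ku_g$ is a $G$-graded ring, each $Ku_g=u_gK$ is free of rank one as a left $K$-module with basis $u_g$, $u_g c=\sigma_g(c)u_g$ for $c\in K$, and, writing $u_gu_h=\alpha(g,h)u_{gh}$ with $\alpha(g,h)\in K$, $\alpha(g,g^{-1})c=0$ implies $c=0$ for all $g\in G$, $c\in K$. A full $R$-lattice in $A$ is an $R$-sub-bimodule $M\subset A$ that is finitely generated as a left and as a right $R$-module and satisfies $KM=A=MK$. A subset $T\subset A$ is graded if $\sum_g x_gu_g\in T$ (with $x_g\in K$) implies $x_gu_g\in T$ for every $g$. A gr-order is a graded full $R$-lattice that is a subring of $A$ containing $1_A$; a gr-maximal order is a gr-order that is maximal, with respect to inclusion, among the gr-orders in $A$. A two-sided graded Ideal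 in a gr-order $\Lambda$ is a two-sided ideal of $\Lambda$ that is a graded full $R$-lattice in $A$. A gr-prime Ideal of $\Lambda$ is a two-sided graded Ideal $P\neq\Lambda$ in $\Lambda$ such that for all two-sided graded Ideals $S,T$ in $\Lambda$, $ST\subset P$ implies $S\subset P$ or $T\subset P$. Products $MN$ are additive subgroups generated by the products $mn$, and for an additive subgroup $M\subset A$ we put $M^{-1}=\{x\in A\mid MxM\subset M\}$. Let $\Lambda$ be a gr-maximal order in $A$. Then for every two-sided graded Ideal $M$ in $\Lambda$ $$MM^{-1}=M^{-1}M=\Lambda,\qquad (M^{-1})^{-1}=M.$$ Furthermore, every two-sided graded Ideal in $\Lambda$ is a product of finitely many gr-prime Ideals of $\Lambda$ (the empty product being $\Lambda$), uniquely up to the order of the factors, and $PQ=QP$ for all gr-prime Ideals $P,Q$ of $\Lambda$. -/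

import Mathlib

open scoped Pointwise

/-- A crystalline graded ring `A = K ◇_{σ,α} G` over the field `K`, where the finite group `G` acts
on a domain `R` with field of fractions `K` and `σ` is the extension of that action to `K`.
The field `K` is embedded in `A` by `ι`, in general not centrally. -/
structure CrystallineGradedRing (R K G A : Type*) [CommRing R] [Field K] [Algebra R K]
    [Group G] [Fintype G] [MulSemiringAction G R] [Ring A] where
  /-- the inclusion of `K` in `A` -/
  ι : K →+* A
  /-- the elements `u_g` -/
  u : G → A
  u_injective : Function.Injective u
  u_ne_zero : ∀ g, u g ≠ 0
  u_one : u 1 = 1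
  /-- `A = ⨁ K u_g`, where each `K u_g` is free of rank one with basis `u_g`. -/
  existsUnique_coeff : ∀ a : A, ∃! c : G → K, ∑ g, ι (c g) * u g = a
  /-- `K u_g = u_g K`. -/
  range_eq : ∀ g, Set.range (fun c : K => ι c * u g) = Set.range (fun c : K => u g * ι c)
  /-- `(K u_g) (K u_h) ⊆ K u_{gh}`. -/
  graded_mul : ∀ (g h : G) (a b : K), ∃ c : K, (ι a * u g) * (ι b * u h) = ι c * u (g * h)
  /-- No torsion: `α(g, g⁻¹) c = 0` only for `c = 0`, where `α(g, g⁻¹) = u_g u_{g⁻¹}`. -/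
  torsionFree : ∀ (g : G) (c : K), u g * u g⁻¹ * ι c = 0 → c = 0
  /-- `u_g r = σ_g(r) u_g`, where `σ` is the given action of `G` on `R`. -/
  u_mul : ∀ (g : G) (r : R),
    u g * ι (algebraMap R K r) = ι (algebraMap R K (g • r)) * u g

namespace CrystallineGradedRing

variable {R K G A : Type*} [CommRing R] [Field K] [Algebra R K]
  [Group G] [Fintype G] [MulSemiringAction G R] [Ring A]

/-- `T ⊆ A` is graded if it contains the homogeneous components of each of its elements. -/
def IsGraded (D : CrystallineGradedRing R K G A) (T : AddSubgroup A) : Prop :=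
  ∀ c : G → K, ∑ g, D.ι (c g) * D.u g ∈ T → ∀ g, D.ι (c g) * D.u g ∈ T

/-- `R`-lattices in `A`: `R`-sub-bimodules that are finitely generated both as left and as right
`R`-modules. They are automatically torsion-free, since nonzero elements of `R` are units of `A`,
and `R^G` automatically acts the same way on both sides, since it is central in `A`. -/
structure IsLattice (D : CrystallineGradedRing R K G A) (M : AddSubgroup A) : Prop where
  left_mem : ∀ (r : R), ∀ m ∈ M, D.ι (algebraMap R K r) * m ∈ M
  right_mem : ∀ (r : R), ∀ m ∈ M, m * D.ι (algebraMap R K r) ∈ M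
  left_fg : ∃ S : Finset A,
    AddSubgroup.closure {x | ∃ r : R, ∃ s ∈ S, x = D.ι (algebraMap R K r) * s} = M
  right_fg : ∃ S : Finset A,
    AddSubgroup.closure {x | ∃ r : R, ∃ s ∈ S, x = s * D.ι (algebraMap R K r)} = M

/-- Full lattices: `K M = A = M K`. -/
structure IsFullLattice (D : CrystallineGradedRing R K G A) (M : AddSubgroup A) : Prop
    extends D.IsLattice M where
  left_full : AddSubgroup.closure {x | ∃ k : K, ∃ m ∈ M, x = D.ι k * m} = ⊤
  right_full : AddSubgroup.closure {x | ∃ k : K, ∃ m ∈ M, x = m * D.ι k} = ⊤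

/-- Graded orders in `A`: graded full lattices that are subrings with the same identity as `A`. -/
structure IsGrOrder (D : CrystallineGradedRing R K G A) (Λ : AddSubgroup A) : Prop
    extends D.IsFullLattice Λ where
  graded : D.IsGraded Λ
  one_mem : (1 : A) ∈ Λ
  mul_mem : ∀ x ∈ Λ, ∀ y ∈ Λ, x * y ∈ Λ

/-- gr-maximal orders: graded orders that are maximal among the graded orders. -/
def IsGrMaximalOrder (D : CrystallineGradedRing R K G A) (Λ : AddSubgroup A) : Prop :=
  Maximal D.IsGrOrder Λ

/-- Two-sided graded Ideals in `Λ`: two-sided ideals of `Λ` that are graded full lattices in `A`. -/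
structure IsTwoSidedGrIdeal (D : CrystallineGradedRing R K G A) (Λ M : AddSubgroup A) : Prop
    extends D.IsFullLattice M where
  graded : D.IsGraded M
  le : M ≤ Λ
  mul_mem_left : ∀ x ∈ Λ, ∀ m ∈ M, x * m ∈ M
  mul_mem_right : ∀ x ∈ Λ, ∀ m ∈ M, m * x ∈ M

/-- gr-prime Ideals of `Λ`. -/
structure IsGrPrime (D : CrystallineGradedRing R K G A) (Λ P : AddSubgroup A) : Prop
    extends D.IsTwoSidedGrIdeal Λ P where
  ne_self : P ≠ Λ
  le_or_le : ∀ S T : AddSubgroup A, D.IsTwoSidedGrIdeal Λ S → D.IsTwoSidedGrIdeal Λ T →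
    S * T ≤ P → S ≤ P ∨ T ≤ P

end CrystallineGradedRing

/-- `M⁻¹ = {x ∈ A | M x M ⊆ M}`. -/
def latticeInv {A : Type*} [Ring A] (M : AddSubgroup A) : AddSubgroup A where
  carrier := {x | ∀ m ∈ M, ∀ n ∈ M, m * x * n ∈ M}
  zero_mem' := fun m _ n _ => by simp [M.zero_mem]
  add_mem' := fun {x y} hx hy m hm n hn => by
    rw [mul_add, add_mul]
    exact M.add_mem (hx m hm n hn) (hy m hm n hn)
  neg_mem' := fun {x} hx m hm n hn => by
    rw [mul_neg, neg_mul]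
    exact M.neg_mem (hx m hm n hn)

/-- The product of a list of ideals of `Λ`, the empty product being `Λ`. -/
def idealProd {A : Type*} [Ring A] (Λ : AddSubgroup A) (l : List (AddSubgroup A)) :
    AddSubgroup A :=
  l.foldr (fun P N => P * N) Λ

/-! The argument follows the ideal theory of maximal orders over Dedekind domains, with graded
ideals throughout. Nonzero $G$-invariant elements of $R$ are central units of $A$, and each nonzero
element of $R$ divides one (its norm), so they serve as common denominators. A graded fractional
ideal is a graded $\Lambda$-bimodule lying between two scalar multiples of $\Lambda$ (`IsFrac`).

By maximality, the left and right multiplier rings of such an ideal $M$ are both $\Lambda$. Hence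
$M^{-1}$ is at once $\{x \mid xM\subset\Lambda\}$ and $\{x \mid Mx\subset\Lambda\}$.

The main difficulty is that gr-primes are maximal (`IsGrPrime.eq_of_lt`). Two facts give it: an
ideal whose degree-one part lies in a gr-prime $P$ lies in $P$ (`IsGrPrime.le_of_proj_one_mem`, a
pigeonhole on degrees), and $P\cap R$ is squarefree (`IsGrPrime.exists_isRadical`). They reduce the
problem to coprime ideals of $R$, which is the degree-one part of $\Lambda$.

Then $P^{-1}\not\subset\Lambda$ (`IsGrPrime.not_latticeInv_le`), by a shortest product of gr-primes
inside $z\Lambda$ with $z\in P$ an invariant scalar. Applied to $MM^{-1}$ and $M^{-1}M$, this gives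
invertibility. Containment thus becomes divisibility, from which commutation of primes, existence
and uniqueness of factorizations follow. -/

namespace AddSubgroup

variable {A : Type*} [Ring A]

protected theorem mul_mem_mul {M N : AddSubgroup A} {m n : A} (hm : m ∈ M) (hn : n ∈ N) :
    m * n ∈ M * N :=
  AddSubmonoid.mul_mem_mul (M := M.toAddSubmonoid) (N := N.toAddSubmonoid) hm hn

protected theorem mul_le {M N L : AddSubgroup A} : M * N ≤ L ↔ ∀ m ∈ M, ∀ n ∈ N, m * n ∈ L :=
  AddSubmonoid.mul_le (M := M.toAddSubmonoid) (N := N.toAddSubmonoid) (P := L.toAddSubmonoid)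

protected theorem mul_le_mul {M N M' N' : AddSubgroup A} (h : M ≤ M') (h' : N ≤ N') :
    M * N ≤ M' * N' :=
  AddSubgroup.mul_le.2 fun _ hm _ hn => AddSubgroup.mul_mem_mul (h hm) (h' hn)

protected theorem mul_assoc (M N L : AddSubgroup A) : M * N * L = M * (N * L) := by
  have h : (M * N * L).toAddSubmonoid = (M * (N * L)).toAddSubmonoid := by
    simp only [mul_toAddSubmonoid, _root_.mul_assoc]
  exact AddSubgroup.toAddSubmonoid_injective h

end AddSubgroup

/-! ### Finiteness over a Noetherian ring, phrased for additive subgroups so as to serve both sides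
of $A$. -/

section Module

variable {R V : Type*} [CommRing R] [AddCommGroup V] [Module R V]

theorem Submodule.span_toAddSubgroup_eq_closure (S : Set V) :
    (Submodule.span R S).toAddSubgroup =
      AddSubgroup.closure {x | ∃ r : R, ∃ s ∈ S, x = r • s} := by
  apply le_antisymm
  · intro x hx
    replace hx : x ∈ Submodule.span R S := hx
    induction hx using Submodule.span_induction with
    | mem x h => exact AddSubgroup.subset_closure ⟨1, x, h, (one_smul _ _).symm⟩
    | zero => exact zero_mem _
    | add x y _ _ hx hy => exact add_mem hx hy
    | smul a x hmem hx =>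
      clear hmem
      induction hx using AddSubgroup.closure_induction with
      | mem x h =>
        obtain ⟨r, s, hs, rfl⟩ := h
        exact AddSubgroup.subset_closure ⟨a * r, s, hs, (mul_smul _ _ _).symm⟩
      | zero => simp
      | add x y _ _ hx hy => rw [smul_add]; exact add_mem hx hy
      | neg x _ hx => rw [smul_neg]; exact neg_mem hx
  · rw [AddSubgroup.closure_le]
    rintro _ ⟨r, s, hs, rfl⟩
    exact Submodule.smul_mem _ _ (Submodule.subset_span hs)

/-- A stable subgroup which is carried into a finitely generated one by an injective linear map is
finitely generated. -/
theorem exists_finset_closure_eq_of_map_le [IsNoetherianRing R] {M N : AddSubgroup V}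
    (hM : ∃ S : Finset V, AddSubgroup.closure {x | ∃ r : R, ∃ s ∈ S, x = r • s} = M)
    (hN : ∀ r : R, ∀ n ∈ N, r • n ∈ N) (f : V →ₗ[R] V) (hf : Function.Injective f)
    (h : ∀ n ∈ N, f n ∈ M) :
    ∃ S : Finset V, AddSubgroup.closure {x | ∃ r : R, ∃ s ∈ S, x = r • s} = N := by
  obtain ⟨S, hS⟩ := hM
  let M' : Submodule R V := Submodule.span R (S : Set V)
  have hM' : M'.toAddSubgroup = M := by
    rw [← hS]; exact Submodule.span_toAddSubgroup_eq_closure _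
  let N' : Submodule R V := { N with smul_mem' := fun r n hn => hN r n hn }
  have : IsNoetherian R M' := isNoetherian_of_fg_of_noetherian _ ⟨S, rfl⟩
  have hle : N'.map f ≤ M' := by
    rintro _ ⟨n, hn, rfl⟩
    have := h n hn
    rw [← hM'] at this
    exact this
  have hfg : (N'.map f).FG := isNoetherian_submodule.1 this _ hle
  obtain ⟨T, hT⟩ := Submodule.fg_of_fg_map_injective f hf hfg
  refine ⟨T, ?_⟩
  have := Submodule.span_toAddSubgroup_eq_closure (R := R) (T : Set V)
  rw [hT] at this
  exact this.symm

/-- Nonempty families of stable subgroups of a finitely generated one have maximal elements. -/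
theorem wellFounded_gt_of_closure_eq [IsNoetherianRing R] {M : AddSubgroup V}
    (hM : ∃ S : Finset V, AddSubgroup.closure {x | ∃ r : R, ∃ s ∈ S, x = r • s} = M)
    (p : AddSubgroup V → Prop) (hp : ∀ N, p N → N ≤ M ∧ ∀ r : R, ∀ n ∈ N, r • n ∈ N) :
    WellFounded fun N N' : {N // p N} => N' < N := by
  obtain ⟨S, hS⟩ := hM
  let M' : Submodule R V := Submodule.span R (S : Set V)
  have hM' : M'.toAddSubgroup = M := by
    rw [← hS]; exact Submodule.span_toAddSubgroup_eq_closure _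
  have : IsNoetherian R M' := isNoetherian_of_fg_of_noetherian _ ⟨S, rfl⟩
  let F : {N // p N} → Submodule R M' := fun N =>
    Submodule.comap M'.subtype { N.1 with smul_mem' := fun r n hn => (hp _ N.2).2 r n hn }
  have hF : ∀ N N' : {N // p N}, N' < N → F N' < F N := by
    intro N N' h
    refine lt_of_le_of_ne (fun x hx => h.le hx) fun he => h.not_ge fun x hx => ?_
    have hxM : x ∈ M' := by
      have := (hp _ N.2).1 hx
      rw [← hM'] at this
      exact this
    have : (⟨x, hxM⟩ : M') ∈ F N := hx
    rw [← he] at this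
    exact this
  exact Subrelation.wf (hF _ _) (InvImage.wf F (wellFounded_gt (α := Submodule R M')))

end Module

namespace CrystallineGradedRing

variable {R K G A : Type*} [CommRing R] [Field K] [Algebra R K]
  [Group G] [Fintype G] [MulSemiringAction G R] [Ring A]
  (D : CrystallineGradedRing R K G A)

/-- The map `R → K → A`. -/
def φ : R →+* A := D.ι.comp (algebraMap R K)

theorem φ_apply (r : R) : D.φ r = D.ι (algebraMap R K r) := rfl

theorem u_mul_φ (g : G) (r : R) : D.u g * D.φ r = D.φ (g • r) * D.u g := D.u_mul g r

theorem φ_mul_ι (r : R) (c : K) : D.φ r * D.ι c = D.ι c * D.φ r := by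
  rw [φ_apply, ← map_mul, ← map_mul, mul_comm]

/-! ### Homogeneous components -/

/-- The coefficients of `a : A` in the basis `u`. -/
noncomputable def coeff (a : A) : G → K := (D.existsUnique_coeff a).choose

theorem sum_coeff (a : A) : ∑ g, D.ι (D.coeff a g) * D.u g = a :=
  (D.existsUnique_coeff a).choose_spec.1

theorem coeff_unique {a : A} {c : G → K} (h : ∑ g, D.ι (c g) * D.u g = a) : c = D.coeff a :=
  (D.existsUnique_coeff a).choose_spec.2 c h

/-- The projection of `A` onto its component `K u_g`. -/
noncomputable def proj (g : G) : A →+ A where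
  toFun a := D.ι (D.coeff a g) * D.u g
  map_zero' := by
    rw [← D.coeff_unique (a := 0) (c := fun _ => 0) (by simp)]
    simp
  map_add' a b := by
    rw [← D.coeff_unique (a := a + b) (c := fun g => D.coeff a g + D.coeff b g)
      (by simp [add_mul, Finset.sum_add_distrib, sum_coeff]), map_add, add_mul]

theorem proj_apply (g : G) (a : A) : D.proj g a = D.ι (D.coeff a g) * D.u g := rfl

theorem sum_proj (a : A) : ∑ g, D.proj g a = a := D.sum_coeff a

theorem proj_ι_mul_u_self (g : G) (c : K) : D.proj g (D.ι c * D.u g) = D.ι c * D.u g := by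
  classical
  rw [proj_apply, ← D.coeff_unique (c := Pi.single g c)]
  · simp
  · rw [Finset.sum_eq_single g] <;> simp +contextual

theorem proj_ι_mul_u_of_ne {g h : G} (hne : g ≠ h) (c : K) : D.proj g (D.ι c * D.u h) = 0 := by
  classical
  rw [proj_apply, ← D.coeff_unique (c := Pi.single h c)]
  · simp [hne]
  · rw [Finset.sum_eq_single h] <;> simp +contextual

theorem proj_proj_self (g : G) (a : A) : D.proj g (D.proj g a) = D.proj g a :=
  D.proj_ι_mul_u_self _ _

theorem proj_proj_of_ne {g h : G} (hne : g ≠ h) (a : A) : D.proj g (D.proj h a) = 0 :=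
  D.proj_ι_mul_u_of_ne hne _

theorem proj_mul_of_eq {g h k : G} {a b : A} (ha : D.proj g a = a) (hb : D.proj h b = b)
    (hk : k = g * h) : D.proj k (a * b) = a * b := by
  subst hk
  obtain ⟨c, hc⟩ := D.graded_mul g h (D.coeff a g) (D.coeff b h)
  rw [← proj_apply, ← proj_apply, ha, hb] at hc
  rw [hc, proj_ι_mul_u_self]

theorem proj_mul_of_ne {g h k : G} {a b : A} (ha : D.proj g a = a) (hb : D.proj h b = b)
    (hk : k ≠ g * h) : D.proj k (a * b) = 0 := by
  rw [← D.proj_mul_of_eq ha hb rfl, proj_proj_of_ne _ hk]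

theorem proj_mul_proj (g h : G) (a b : A) :
    D.proj (g * h) (a * D.proj h b) = D.proj g a * D.proj h b := by
  conv_lhs => rw [← D.sum_proj a, Finset.sum_mul, map_sum]
  rw [Finset.sum_eq_single g]
  · exact D.proj_mul_of_eq (D.proj_proj_self _ _) (D.proj_proj_self _ _) rfl
  · intro k _ hk
    exact D.proj_mul_of_ne (D.proj_proj_self _ _) (D.proj_proj_self _ _) (by simpa using hk.symm)
  · simp

theorem proj_proj_mul (g h : G) (a b : A) :
    D.proj (g * h) (D.proj g a * b) = D.proj g a * D.proj h b := by
  conv_lhs => rw [← D.sum_proj b, Finset.mul_sum, map_sum]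
  rw [Finset.sum_eq_single h]
  · exact D.proj_mul_of_eq (D.proj_proj_self _ _) (D.proj_proj_self _ _) rfl
  · intro k _ hk
    exact D.proj_mul_of_ne (D.proj_proj_self _ _) (D.proj_proj_self _ _) (by simpa using hk.symm)
  · simp

theorem proj_mul (k : G) (a b : A) :
    D.proj k (a * b) = ∑ g, D.proj g a * D.proj (g⁻¹ * k) b := by
  conv_lhs => rw [← D.sum_proj a, Finset.sum_mul, map_sum]
  refine Finset.sum_congr rfl fun g _ => ?_
  rw [← proj_proj_mul, mul_inv_cancel_left]

theorem proj_one_ι (c : K) : D.proj 1 (D.ι c) = D.ι c := by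
  simpa [D.u_one] using D.proj_ι_mul_u_self 1 c

theorem proj_one_φ (r : R) : D.proj 1 (D.φ r) = D.φ r := D.proj_one_ι _

theorem proj_one_apply (a : A) : D.proj 1 a = D.ι (D.coeff a 1) := by
  rw [proj_apply, D.u_one, mul_one]

theorem proj_φ_mul (g : G) (r : R) (a : A) : D.proj g (D.φ r * a) = D.φ r * D.proj g a := by
  have := D.proj_proj_mul 1 g (D.φ r) a
  rwa [one_mul, proj_one_φ] at this

theorem proj_mul_φ (g : G) (r : R) (a : A) : D.proj g (a * D.φ r) = D.proj g a * D.φ r := by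
  have := D.proj_mul_proj g 1 a (D.φ r)
  rwa [mul_one, proj_one_φ] at this

theorem proj_mul_φ_eq (g : G) (r : R) (a : A) :
    D.proj g a * D.φ r = D.φ (g • r) * D.proj g a := by
  rw [proj_apply, mul_assoc, u_mul_φ, ← mul_assoc, ← mul_assoc, φ_mul_ι]

theorem isGraded_iff {T : AddSubgroup A} :
    D.IsGraded T ↔ ∀ g, ∀ x ∈ T, D.proj g x ∈ T := by
  constructor
  · intro h g x hx
    exact h (D.coeff x) (by rwa [sum_coeff]) g
  · intro h c hc g
    have := h g _ hc
    rwa [proj_apply, ← D.coeff_unique rfl] at this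

theorem IsGraded.proj_mem {T : AddSubgroup A} (h : D.IsGraded T) (g : G) {x : A} (hx : x ∈ T) :
    D.proj g x ∈ T := D.isGraded_iff.1 h g x hx

/-- Membership may be checked on homogeneous components. -/
theorem mem_of_proj_mem {T : AddSubgroup A} {x : A} (h : ∀ g, D.proj g x ∈ T) : x ∈ T := by
  rw [← D.sum_proj x]
  exact sum_mem fun g _ => h g

theorem IsGraded.mul {M N : AddSubgroup A} (hM : D.IsGraded M) (hN : D.IsGraded N) :
    D.IsGraded (M * N) := by
  rw [isGraded_iff]
  intro g
  change M * N ≤ (M * N).comap (D.proj g)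
  rw [AddSubgroup.mul_le]
  intro m hm n hn
  rw [AddSubgroup.mem_comap, proj_mul]
  exact sum_mem fun h _ => AddSubgroup.mul_mem_mul (hM.proj_mem D _ hm) (hN.proj_mem D _ hn)

theorem IsGraded.sup {M N : AddSubgroup A} (hM : D.IsGraded M) (hN : D.IsGraded N) :
    D.IsGraded (M ⊔ N) := by
  rw [isGraded_iff]
  intro g
  change M ⊔ N ≤ (M ⊔ N).comap (D.proj g)
  exact sup_le (fun x hx => AddSubgroup.mem_sup_left (hM.proj_mem D _ hx))
    fun x hx => AddSubgroup.mem_sup_right (hN.proj_mem D _ hx)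

theorem IsGraded.inf {M N : AddSubgroup A} (hM : D.IsGraded M) (hN : D.IsGraded N) :
    D.IsGraded (M ⊓ N) := by
  rw [isGraded_iff]
  exact fun g x hx => ⟨hM.proj_mem D _ hx.1, hN.proj_mem D _ hx.2⟩

/-- `{x | x M ⊆ L}` -/
def leftTransporter (M L : AddSubgroup A) : AddSubgroup A where
  carrier := {x | ∀ m ∈ M, x * m ∈ L}
  zero_mem' m _ := by simp
  add_mem' hx hy m hm := by rw [add_mul]; exact L.add_mem (hx m hm) (hy m hm)
  neg_mem' hx m hm := by rw [neg_mul]; exact L.neg_mem (hx m hm)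

/-- `{x | M x ⊆ L}` -/
def rightTransporter (M L : AddSubgroup A) : AddSubgroup A where
  carrier := {x | ∀ m ∈ M, m * x ∈ L}
  zero_mem' m _ := by simp
  add_mem' hx hy m hm := by rw [mul_add]; exact L.add_mem (hx m hm) (hy m hm)
  neg_mem' hx m hm := by rw [mul_neg]; exact L.neg_mem (hx m hm)

/-- The degree-$h$ part of $x_g m$ equals that of $x\,m_{g^{-1}h}$, and the latter lies in $L$
because $M$ and $L$ are graded. -/
theorem IsGraded.leftTransporter {M L : AddSubgroup A} (hM : D.IsGraded M) (hL : D.IsGraded L) :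
    D.IsGraded (leftTransporter M L) := by
  rw [isGraded_iff]
  intro g x hx m hm
  refine D.mem_of_proj_mem fun h => ?_
  have := hL.proj_mem D h (hx _ (hM.proj_mem D (g⁻¹ * h) hm))
  have h2 := D.proj_mul_proj g (g⁻¹ * h) x m
  have h3 := D.proj_proj_mul g (g⁻¹ * h) x m
  rw [mul_inv_cancel_left] at h2 h3
  rwa [h3, ← h2]

theorem IsGraded.rightTransporter {M L : AddSubgroup A} (hM : D.IsGraded M) (hL : D.IsGraded L) :
    D.IsGraded (rightTransporter M L) := by
  rw [isGraded_iff]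
  intro g x hx m hm
  refine D.mem_of_proj_mem fun h => ?_
  have := hL.proj_mem D h (hx _ (hM.proj_mem D (h * g⁻¹) hm))
  have h2 := D.proj_mul_proj (h * g⁻¹) g m x
  have h3 := D.proj_proj_mul (h * g⁻¹) g m x
  rw [inv_mul_cancel_right] at h2 h3
  rwa [h2, ← h3]

/-! ### Invariant scalars -/

/-- Being the image in `A` of a nonzero `G`-invariant element of `R`. -/
def IsScal (a : A) : Prop := ∃ r : R, r ≠ 0 ∧ (∀ g : G, g • r = r) ∧ D.φ r = a

variable {D}

theorem IsScal.commute {z : A} (hz : D.IsScal z) (a : A) : z * a = a * z := by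
  obtain ⟨r, -, hr, rfl⟩ := hz
  rw [← D.sum_proj a, Finset.mul_sum, Finset.sum_mul]
  refine Finset.sum_congr rfl fun g _ => ?_
  rw [proj_mul_φ_eq, hr]

theorem IsScal.one : D.IsScal (1 : A) := by
  refine ⟨1, ?_, by simp, map_one _⟩
  rintro h
  have h0 := D.u_ne_zero 1
  rw [D.u_one, ← map_one D.φ, h, map_zero] at h0
  exact h0 rfl

theorem IsScal.mul [IsDomain R] {z w : A} (hz : D.IsScal z) (hw : D.IsScal w) :
    D.IsScal (z * w) := by
  obtain ⟨r, h0, hr, rfl⟩ := hz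
  obtain ⟨s, h0', hs, rfl⟩ := hw
  exact ⟨r * s, mul_ne_zero h0 h0', fun g => by rw [smul_mul', hr, hs], map_mul _ _ _⟩

theorem IsScal.exists_inv [IsFractionRing R K] {z : A} (hz : D.IsScal z) :
    ∃ y, y * z = 1 ∧ z * y = 1 := by
  obtain ⟨r, h0, hr, rfl⟩ := hz
  have h : algebraMap R K r ≠ 0 := by simpa using h0
  exact ⟨D.ι (algebraMap R K r)⁻¹, by rw [φ_apply, ← map_mul, inv_mul_cancel₀ h, map_one],
    by rw [φ_apply, ← map_mul, mul_inv_cancel₀ h, map_one]⟩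

-- The cofactor comes from the norm $\prod_g g\cdot r$, which is invariant and has $r$ as a factor.
variable (D) in
theorem exists_dvd_mem_scal [IsDomain R] {r : R} (hr : r ≠ 0) :
    ∃ s : R, D.IsScal (D.φ (r * s)) := by
  classical
  have : r ∣ ∏ g : G, g • r := by
    have := Finset.dvd_prod_of_mem (fun g : G => g • r) (Finset.mem_univ 1)
    simpa using this
  obtain ⟨s, hs⟩ := this
  refine ⟨s, _, ?_, ?_, congrArg _ hs⟩
  · rw [Finset.prod_ne_zero_iff]
    intro g _ h
    exact hr ((smul_eq_zero_iff_eq g).1 h)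
  · intro g
    rw [Finset.smul_prod']
    simp_rw [smul_smul]
    exact Fintype.prod_equiv (Equiv.mulLeft g) _ _ fun _ => rfl

end CrystallineGradedRing

namespace CrystallineGradedRing

variable {R K G A : Type*} [CommRing R] [Field K] [Algebra R K]
  [Group G] [Fintype G] [MulSemiringAction G R] [Ring A]
  {D : CrystallineGradedRing R K G A} {Λ M N P Q S T : AddSubgroup A}

/-! ### Comparison of full lattices -/

theorem IsFullLattice.exists_scal_mul_mem [IsDomain R] [IsFractionRing R K]
    (hM : D.IsFullLattice M) (a : A) : ∃ z, D.IsScal z ∧ z * a ∈ M := by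
  have ha : a ∈ AddSubgroup.closure {x | ∃ k : K, ∃ m ∈ M, x = D.ι k * m} := by
    rw [hM.left_full]; trivial
  induction ha using AddSubgroup.closure_induction with
  | mem x hx =>
    obtain ⟨k, m, hm, rfl⟩ := hx
    obtain ⟨r, s, hs, rfl⟩ := IsFractionRing.div_surjective (A := R) k
    have hs0 := nonZeroDivisors.ne_zero hs
    -- The denominator $s$ is enlarged to an invariant, hence central, multiple $st$.
    obtain ⟨t, ht⟩ := D.exists_dvd_mem_scal hs0
    refine ⟨_, ht, ?_⟩
    have hsK : algebraMap R K s ≠ 0 := by simpa using hs0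
    rw [← mul_assoc, φ_apply, ← map_mul, map_mul (algebraMap R K)]
    have : algebraMap R K s * algebraMap R K t * (algebraMap R K r / algebraMap R K s)
        = algebraMap R K (t * r) := by
      rw [map_mul]; field_simp
    rw [this]
    exact hM.left_mem _ _ hm
  | zero => exact ⟨1, IsScal.one, by simp⟩
  | add x y _ _ hx hy =>
    obtain ⟨z, hz, hzx⟩ := hx
    obtain ⟨w, hw, hwy⟩ := hy
    refine ⟨z * w, IsScal.mul hz hw, ?_⟩
    rw [mul_add]
    refine M.add_mem ?_ ?_
    · rw [hz.commute, mul_assoc]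
      obtain ⟨r, -, -, rfl⟩ := hw
      exact hM.left_mem r _ hzx
    · rw [mul_assoc]
      obtain ⟨r, -, -, rfl⟩ := hz
      exact hM.left_mem r _ hwy
  | neg x _ hx =>
    obtain ⟨z, hz, hzx⟩ := hx
    exact ⟨z, hz, by rw [mul_neg]; exact M.neg_mem hzx⟩

theorem IsFullLattice.exists_scal_forall_mul_mem [IsDomain R] [IsFractionRing R K]
    (hM : D.IsFullLattice M) (hN : D.IsFullLattice N) : ∃ z, D.IsScal z ∧ ∀ x ∈ N, z * x ∈ M := by
  classical
  obtain ⟨S, hS⟩ := hN.left_fg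
  have h : ∃ z, D.IsScal z ∧ ∀ s ∈ S, z * s ∈ M := by
    clear hS
    induction S using Finset.induction_on with
    | empty => exact ⟨1, IsScal.one, by simp⟩
    | insert a S _ ih =>
      obtain ⟨z, hz, h⟩ := ih
      obtain ⟨w, hw, h'⟩ := hM.exists_scal_mul_mem a
      refine ⟨z * w, IsScal.mul hz hw, fun s hs => ?_⟩
      rcases Finset.mem_insert.1 hs with rfl | hs
      · rw [mul_assoc]
        obtain ⟨r, -, -, rfl⟩ := hz
        exact hM.left_mem r _ h'
      · rw [hz.commute, mul_assoc]
        obtain ⟨r, -, -, rfl⟩ := hw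
        exact hM.left_mem r _ (h s hs)
  obtain ⟨z, hz, h⟩ := h
  refine ⟨z, hz, ?_⟩
  change N ≤ M.comap (AddMonoidHom.mulLeft z)
  rw [← hS, AddSubgroup.closure_le]
  rintro _ ⟨r, s, hs, rfl⟩
  change z * (D.φ r * s) ∈ M
  rw [← mul_assoc, hz.commute, mul_assoc]
  exact hM.left_mem r _ (h s hs)

/-- A sub-bimodule lying between two multiples of a full lattice is a full lattice. -/
theorem IsFullLattice.of_scal [IsNoetherianRing R] [IsFractionRing R K]
    (hM : D.IsFullLattice M) (hl : ∀ r : R, ∀ n ∈ N, D.φ r * n ∈ N)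
    (hr : ∀ r : R, ∀ n ∈ N, n * D.φ r ∈ N) {z w : A} (hz : D.IsScal z) (hw : D.IsScal w)
    (hzM : ∀ x ∈ M, z * x ∈ N) (hwN : ∀ x ∈ N, w * x ∈ M) : D.IsFullLattice N := by
  -- Multiplication by the central unit $w$ embeds $N$ in $M$ and is linear for both the left and
  -- the right $R$-structure, so finite generation passes to $N$ on each side.
  have hinj : Function.Injective fun x => w * x := by
    obtain ⟨y, hy, -⟩ := hw.exists_inv
    intro a b h
    have := congrArg (y * ·) h
    simpa [← mul_assoc, hy] using this
  refine ⟨⟨hl, hr, ?_, ?_⟩, ?_, ?_⟩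
  · let _ : Module R A := Module.compHom A D.φ
    have hsmul : ∀ (r : R) (a : A), r • a = D.φ r * a := fun _ _ => rfl
    exact exists_finset_closure_eq_of_map_le (R := R) hM.left_fg hl
      { toFun := fun x => w * x
        map_add' := mul_add w
        map_smul' := fun r x => by
          simp only [hsmul, RingHom.id_apply]
          rw [← mul_assoc, hw.commute, mul_assoc] } hinj hwN
  · let _ : Module R A :=
      { smul := fun r a => a * D.φ r
        one_smul := fun a => by change a * D.φ 1 = a; simp
        mul_smul := fun r s a => by
          change a * D.φ (r * s) = a * D.φ s * D.φ r
          rw [mul_assoc, ← map_mul, mul_comm]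
        smul_zero := fun r => zero_mul _
        smul_add := fun r a b => add_mul _ _ _
        add_smul := fun r s a => by
          change a * D.φ (r + s) = a * D.φ r + a * D.φ s
          rw [map_add, mul_add]
        zero_smul := fun a => by change a * D.φ 0 = 0; simp }
    exact exists_finset_closure_eq_of_map_le (R := R) hM.right_fg hr
      { toFun := fun x => w * x
        map_add' := mul_add w
        map_smul' := fun r x => (mul_assoc w x (D.φ r)).symm } hinj hwN
  · rw [eq_top_iff, ← hM.left_full, AddSubgroup.closure_le]
    rintro _ ⟨k, m, hm, rfl⟩
    obtain ⟨r, h0, hr, rfl⟩ := hz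
    have h : algebraMap R K r ≠ 0 := by simpa using h0
    refine AddSubgroup.subset_closure ⟨k * (algebraMap R K r)⁻¹, _, hzM m hm, ?_⟩
    rw [φ_apply, ← mul_assoc, ← map_mul, inv_mul_cancel_right₀ h]
  · rw [eq_top_iff, ← hM.right_full, AddSubgroup.closure_le]
    rintro _ ⟨k, m, hm, rfl⟩
    have hc := hz.commute
    obtain ⟨r, h0, hr, rfl⟩ := hz
    have h : algebraMap R K r ≠ 0 := by simpa using h0
    refine AddSubgroup.subset_closure ⟨(algebraMap R K r)⁻¹ * k, _, hzM m hm, ?_⟩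
    rw [hc, φ_apply, mul_assoc, ← map_mul, mul_inv_cancel_left₀ h]

/-! ### Fractional two-sided ideals -/

variable (D) in
/-- Graded fractional two-sided ideals of `Λ`. -/
structure IsFrac (Λ N : AddSubgroup A) : Prop where
  graded : D.IsGraded N
  mul_mem_left : ∀ x ∈ Λ, ∀ m ∈ N, x * m ∈ N
  mul_mem_right : ∀ x ∈ Λ, ∀ m ∈ N, m * x ∈ N
  scal_le : ∃ z, D.IsScal z ∧ ∀ x ∈ Λ, z * x ∈ N
  le_scal : ∃ z, D.IsScal z ∧ ∀ x ∈ N, z * x ∈ Λ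

theorem IsGrOrder.φ_mem (hΛ : D.IsGrOrder Λ) (r : R) : D.φ r ∈ Λ := by
  simpa [φ_apply] using hΛ.left_mem r 1 hΛ.one_mem

theorem IsGrOrder.scal_mem (hΛ : D.IsGrOrder Λ) {z : A} (hz : D.IsScal z) : z ∈ Λ := by
  obtain ⟨r, -, -, rfl⟩ := hz
  exact hΛ.φ_mem r

/-- Trades the lattice conditions for two scalar bounds, which are easy to carry through products,
sums, intersections and transporters. -/
theorem IsTwoSidedGrIdeal.isFrac [IsDomain R] [IsFractionRing R K] (hΛ : D.IsGrOrder Λ)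
    (hM : D.IsTwoSidedGrIdeal Λ M) : D.IsFrac Λ M where
  graded := hM.graded
  mul_mem_left := hM.mul_mem_left
  mul_mem_right := hM.mul_mem_right
  scal_le := hM.toIsFullLattice.exists_scal_forall_mul_mem hΛ.toIsFullLattice
  le_scal := hΛ.toIsFullLattice.exists_scal_forall_mul_mem hM.toIsFullLattice

theorem IsFrac.isTwoSidedGrIdeal [IsNoetherianRing R] [IsFractionRing R K] (hΛ : D.IsGrOrder Λ)
    (hM : D.IsFrac Λ M) (hle : M ≤ Λ) : D.IsTwoSidedGrIdeal Λ M := by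
  obtain ⟨z, hz, hzM⟩ := hM.scal_le
  obtain ⟨w, hw, hwM⟩ := hM.le_scal
  exact { hΛ.toIsFullLattice.of_scal (fun r n hn => hM.mul_mem_left _ (hΛ.φ_mem r) n hn)
    (fun r n hn => hM.mul_mem_right _ (hΛ.φ_mem r) n hn) hz hw hzM hwM with
    graded := hM.graded
    le := hle
    mul_mem_left := hM.mul_mem_left
    mul_mem_right := hM.mul_mem_right }

theorem IsGrOrder.isFrac (hΛ : D.IsGrOrder Λ) : D.IsFrac Λ Λ where
  graded := hΛ.graded
  mul_mem_left := hΛ.mul_mem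
  mul_mem_right x hx m hm := hΛ.mul_mem m hm x hx
  scal_le := ⟨1, IsScal.one, by simp⟩
  le_scal := ⟨1, IsScal.one, by simp⟩

theorem IsFrac.mul [IsDomain R] (hΛ : D.IsGrOrder Λ) (hM : D.IsFrac Λ M) (hN : D.IsFrac Λ N) :
    D.IsFrac Λ (M * N) where
  graded := hM.graded.mul D hN.graded
  mul_mem_left x hx := by
    change M * N ≤ (M * N).comap (AddMonoidHom.mulLeft x)
    rw [AddSubgroup.mul_le]
    intro m hm n hn
    change x * (m * n) ∈ M * N
    rw [← mul_assoc]
    exact AddSubgroup.mul_mem_mul (hM.mul_mem_left x hx m hm) hn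
  mul_mem_right x hx := by
    change M * N ≤ (M * N).comap (AddMonoidHom.mulRight x)
    rw [AddSubgroup.mul_le]
    intro m hm n hn
    change m * n * x ∈ M * N
    rw [mul_assoc]
    exact AddSubgroup.mul_mem_mul hm (hN.mul_mem_right x hx n hn)
  scal_le := by
    obtain ⟨z, hz, hzM⟩ := hM.scal_le
    obtain ⟨w, hw, hwM⟩ := hN.scal_le
    refine ⟨z * w, hz.mul hw, fun x hx => ?_⟩
    rw [mul_assoc]
    refine AddSubgroup.mul_mem_mul ?_ (hwM x hx)
    simpa using hzM 1 hΛ.one_mem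
  le_scal := by
    obtain ⟨z, hz, hzM⟩ := hM.le_scal
    obtain ⟨w, hw, hwM⟩ := hN.le_scal
    refine ⟨z * w, hz.mul hw, ?_⟩
    change M * N ≤ Λ.comap (AddMonoidHom.mulLeft (z * w))
    rw [AddSubgroup.mul_le]
    intro m hm n hn
    change z * w * (m * n) ∈ Λ
    rw [mul_assoc, ← mul_assoc w, hw.commute, mul_assoc m, ← mul_assoc]
    exact hΛ.mul_mem _ (hzM m hm) _ (hwM n hn)

theorem IsFrac.sup [IsDomain R] (hΛ : D.IsGrOrder Λ) (hM : D.IsFrac Λ M) (hN : D.IsFrac Λ N) :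
    D.IsFrac Λ (M ⊔ N) where
  graded := hM.graded.sup D hN.graded
  mul_mem_left x hx := by
    change M ⊔ N ≤ (M ⊔ N).comap (AddMonoidHom.mulLeft x)
    exact sup_le (fun m hm => AddSubgroup.mem_sup_left (hM.mul_mem_left x hx m hm))
      fun m hm => AddSubgroup.mem_sup_right (hN.mul_mem_left x hx m hm)
  mul_mem_right x hx := by
    change M ⊔ N ≤ (M ⊔ N).comap (AddMonoidHom.mulRight x)
    exact sup_le (fun m hm => AddSubgroup.mem_sup_left (hM.mul_mem_right x hx m hm))
      fun m hm => AddSubgroup.mem_sup_right (hN.mul_mem_right x hx m hm)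
  scal_le := by
    obtain ⟨z, hz, hzM⟩ := hM.scal_le
    exact ⟨z, hz, fun x hx => AddSubgroup.mem_sup_left (hzM x hx)⟩
  le_scal := by
    obtain ⟨z, hz, hzM⟩ := hM.le_scal
    obtain ⟨w, hw, hwM⟩ := hN.le_scal
    refine ⟨z * w, hz.mul hw, ?_⟩
    change M ⊔ N ≤ Λ.comap (AddMonoidHom.mulLeft (z * w))
    refine sup_le (fun m hm => ?_) fun n hn => ?_
    · change z * w * m ∈ Λ
      rw [hz.commute, mul_assoc]
      exact hΛ.mul_mem _ (hΛ.scal_mem hw) _ (hzM m hm)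
    · change z * w * n ∈ Λ
      rw [mul_assoc]
      exact hΛ.mul_mem _ (hΛ.scal_mem hz) _ (hwM n hn)

theorem IsFrac.inf [IsDomain R] (hΛ : D.IsGrOrder Λ) (hM : D.IsFrac Λ M) (hN : D.IsFrac Λ N) :
    D.IsFrac Λ (M ⊓ N) where
  graded := hM.graded.inf D hN.graded
  mul_mem_left x hx m hm := ⟨hM.mul_mem_left x hx m hm.1, hN.mul_mem_left x hx m hm.2⟩
  mul_mem_right x hx m hm := ⟨hM.mul_mem_right x hx m hm.1, hN.mul_mem_right x hx m hm.2⟩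
  scal_le := by
    obtain ⟨z, hz, hzM⟩ := hM.scal_le
    obtain ⟨w, hw, hwM⟩ := hN.scal_le
    refine ⟨z * w, hz.mul hw, fun x hx => ⟨?_, ?_⟩⟩
    · rw [mul_assoc]
      exact hzM _ (hΛ.mul_mem _ (hΛ.scal_mem hw) _ hx)
    · rw [hz.commute, mul_assoc]
      exact hwM _ (hΛ.mul_mem _ (hΛ.scal_mem hz) _ hx)
  le_scal := by
    obtain ⟨z, hz, hzM⟩ := hM.le_scal
    exact ⟨z, hz, fun x hx => hzM x hx.1⟩

theorem IsFrac.leftTransporter [IsDomain R] (hΛ : D.IsGrOrder Λ) (hM : D.IsFrac Λ M)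
    (hN : D.IsFrac Λ N) : D.IsFrac Λ (leftTransporter M N) where
  graded := hM.graded.leftTransporter D hN.graded
  mul_mem_left x hx m hm n hn := by
    rw [mul_assoc]; exact hN.mul_mem_left x hx _ (hm n hn)
  mul_mem_right x hx m hm n hn := by
    rw [mul_assoc]; exact hm _ (hM.mul_mem_left x hx n hn)
  scal_le := by
    obtain ⟨z, hz, hzM⟩ := hM.le_scal
    obtain ⟨w, hw, hwM⟩ := hN.scal_le
    refine ⟨w * z, hw.mul hz, fun x hx m hm => ?_⟩
    rw [mul_assoc w, hz.commute, mul_assoc, mul_assoc]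
    exact hwM _ (hΛ.mul_mem _ hx _ (hzM m hm))
  le_scal := by
    obtain ⟨z, hz, hzM⟩ := hM.scal_le
    obtain ⟨w, hw, hwM⟩ := hN.le_scal
    refine ⟨w * z, hw.mul hz, fun x hx => ?_⟩
    rw [mul_assoc, hz.commute]
    refine hwM _ (hx _ ?_)
    simpa using hzM 1 hΛ.one_mem

theorem IsFrac.rightTransporter [IsDomain R] (hΛ : D.IsGrOrder Λ) (hM : D.IsFrac Λ M)
    (hN : D.IsFrac Λ N) : D.IsFrac Λ (rightTransporter M N) where
  graded := hM.graded.rightTransporter D hN.graded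
  mul_mem_left x hx m hm n hn := by
    rw [← mul_assoc]; exact hm _ (hM.mul_mem_right x hx n hn)
  mul_mem_right x hx m hm n hn := by
    rw [← mul_assoc]; exact hN.mul_mem_right x hx _ (hm n hn)
  scal_le := by
    obtain ⟨z, hz, hzM⟩ := hM.le_scal
    obtain ⟨w, hw, hwM⟩ := hN.scal_le
    refine ⟨w * z, hw.mul hz, fun x hx m hm => ?_⟩
    rw [← mul_assoc, ← (hw.mul hz).commute, mul_assoc, mul_assoc, ← mul_assoc z]
    exact hwM _ (hΛ.mul_mem _ (hzM m hm) _ hx)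
  le_scal := by
    obtain ⟨z, hz, hzM⟩ := hM.scal_le
    obtain ⟨w, hw, hwM⟩ := hN.le_scal
    refine ⟨w * z, hw.mul hz, fun x hx => ?_⟩
    rw [mul_assoc]
    refine hwM _ (hx _ ?_)
    simpa using hzM 1 hΛ.one_mem

/-! ### Maximality -/

/-- The left multiplier ring of $M$ is graded, closed under multiplication and bounded by scalars,
so it is a gr-order containing $\Lambda$; maximality forces equality. -/
theorem IsGrMaximalOrder.leftTransporter_self [IsDedekindDomain R] [IsFractionRing R K]
    (hΛ : D.IsGrMaximalOrder Λ) (hM : D.IsFrac Λ M) : leftTransporter M M = Λ := by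
  have hO := hM.leftTransporter hΛ.prop hM
  have hle : Λ ≤ CrystallineGradedRing.leftTransporter M M := fun x hx m hm =>
    hM.mul_mem_left x hx m hm
  obtain ⟨z, hz, hzM⟩ := hO.scal_le
  obtain ⟨w, hw, hwM⟩ := hO.le_scal
  have hF := hΛ.prop.toIsFullLattice.of_scal
    (fun r n hn => hO.mul_mem_left _ (hΛ.prop.φ_mem r) n hn)
    (fun r n hn => hO.mul_mem_right _ (hΛ.prop.φ_mem r) n hn) hz hw hzM hwM
  refine (hΛ.eq_of_le { hF with
    graded := hO.graded
    one_mem := hle hΛ.prop.one_mem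
    mul_mem := fun x hx y hy m hm => ?_ } hle).symm
  rw [mul_assoc]
  exact hx _ (hy m hm)

theorem IsGrMaximalOrder.rightTransporter_self [IsDedekindDomain R] [IsFractionRing R K]
    (hΛ : D.IsGrMaximalOrder Λ) (hM : D.IsFrac Λ M) : rightTransporter M M = Λ := by
  have hO := hM.rightTransporter hΛ.prop hM
  have hle : Λ ≤ CrystallineGradedRing.rightTransporter M M := fun x hx m hm =>
    hM.mul_mem_right x hx m hm
  obtain ⟨z, hz, hzM⟩ := hO.scal_le
  obtain ⟨w, hw, hwM⟩ := hO.le_scal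
  have hF := hΛ.prop.toIsFullLattice.of_scal
    (fun r n hn => hO.mul_mem_left _ (hΛ.prop.φ_mem r) n hn)
    (fun r n hn => hO.mul_mem_right _ (hΛ.prop.φ_mem r) n hn) hz hw hzM hwM
  refine (hΛ.eq_of_le { hF with
    graded := hO.graded
    one_mem := hle hΛ.prop.one_mem
    mul_mem := fun x hx y hy m hm => ?_ } hle).symm
  rw [← mul_assoc]
  exact hy _ (hx m hm)

/-- $MxM\subset M$ says that $xM$ lies in the right multiplier ring of $M$, which is $\Lambda$. -/
theorem IsGrMaximalOrder.latticeInv_eq_left [IsDedekindDomain R] [IsFractionRing R K]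
    (hΛ : D.IsGrMaximalOrder Λ) (hM : D.IsFrac Λ M) : latticeInv M = leftTransporter M Λ := by
  have h := hΛ.rightTransporter_self hM
  ext x
  constructor
  · intro hx m hm
    rw [← h]
    intro n hn
    rw [← mul_assoc]
    exact hx n hn m hm
  · intro hx m hm n hn
    rw [mul_assoc]
    exact hM.mul_mem_right _ (hx n hn) m hm

theorem IsGrMaximalOrder.latticeInv_eq_right [IsDedekindDomain R] [IsFractionRing R K]
    (hΛ : D.IsGrMaximalOrder Λ) (hM : D.IsFrac Λ M) : latticeInv M = rightTransporter M Λ := by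
  have h := hΛ.leftTransporter_self hM
  ext x
  constructor
  · intro hx m hm
    rw [← h]
    intro n hn
    exact hx m hm n hn
  · intro hx m hm n hn
    exact hM.mul_mem_left _ (hx m hm) n hn

theorem IsGrMaximalOrder.isFrac_latticeInv [IsDedekindDomain R] [IsFractionRing R K]
    (hΛ : D.IsGrMaximalOrder Λ) (hM : D.IsFrac Λ M) : D.IsFrac Λ (latticeInv M) := by
  rw [hΛ.latticeInv_eq_left hM]
  exact hM.leftTransporter hΛ.prop hΛ.prop.isFrac

end CrystallineGradedRing

/-! ### Radical ideals of Dedekind domains -/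

/-- If $c=d^2k$, then $(dk)^2\subset c$, so $dk\subset c$; thus $d\cdot dk$ divides $dk$, and
cancelling $dk$ makes $d$ a unit. -/
theorem Ideal.squarefree_of_isRadical {R : Type*} [CommRing R] [IsDedekindDomain R] {c : Ideal R}
    (hc : c.IsRadical) (h0 : c ≠ ⊥) : Squarefree c := by
  rintro d ⟨k, hk⟩
  have hle : d * k ≤ c := by
    intro x hx
    refine hc ⟨2, ?_⟩
    rw [hk, pow_two]
    have : x * x ∈ d * k * (d * k) := Ideal.mul_mem_mul hx hx
    have h2 : d * k * (d * k) = d * d * k * k := by ring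
    rw [h2] at this
    exact Ideal.mul_le_left this
  have hne : d * k ≠ 0 := by
    intro h
    rw [mul_assoc, h, mul_zero] at hk
    exact h0 hk
  have hdvd : d * (d * k) ∣ 1 * (d * k) := by
    rw [one_mul, Ideal.dvd_iff_le, ← mul_assoc, ← hk]
    exact hle
  exact isUnit_of_dvd_one ((mul_dvd_mul_iff_right hne).1 hdvd)

namespace CrystallineGradedRing

variable {R K G A : Type*} [CommRing R] [Field K] [Algebra R K]
  [Group G] [Fintype G] [MulSemiringAction G R] [Ring A]
  {D : CrystallineGradedRing R K G A} {Λ M N P Q S T : AddSubgroup A}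

/-! ### The component of degree one -/

/-- $\Lambda\cap K$ is an $R$-subalgebra of $K$, finite over $R$ because it sits in the finitely
generated $\Lambda$. Its elements are integral, and $R$ is integrally closed. -/
theorem IsGrOrder.exists_φ_eq_ι [IsDedekindDomain R] [IsFractionRing R K] (hΛ : D.IsGrOrder Λ)
    {c : K} (hc : D.ι c ∈ Λ) : ∃ r, D.φ r = D.ι c := by
  let _ : Module R A := Module.compHom A D.φ
  have hsmul : ∀ (r : R) (a : A), r • a = D.φ r * a := fun _ _ => rfl
  let B : Subalgebra R K :=
    { carrier := {c | D.ι c ∈ Λ}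
      mul_mem' := fun {a b} ha hb => by
        change D.ι (a * b) ∈ Λ
        rw [map_mul]; exact hΛ.mul_mem _ ha _ hb
      add_mem' := fun {a b} ha hb => by
        change D.ι (a + b) ∈ Λ
        rw [map_add]; exact Λ.add_mem ha hb
      algebraMap_mem' := hΛ.φ_mem }
  let f : K →ₗ[R] A :=
    { toFun := D.ι
      map_add' := map_add _
      map_smul' := fun r x => by rw [Algebra.smul_def, map_mul]; rfl }
  have : Nontrivial A := ⟨D.u 1, 0, D.u_ne_zero 1⟩
  have hf : Function.Injective f := D.ι.injective
  obtain ⟨S, hS⟩ := hΛ.left_fg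
  have hN : IsNoetherian R (Submodule.span R (S : Set A)) :=
    isNoetherian_of_fg_of_noetherian _ ⟨S, rfl⟩
  have hle : (Subalgebra.toSubmodule B).map f ≤ Submodule.span R (S : Set A) := by
    rintro _ ⟨x, hx, rfl⟩
    have h : D.ι x ∈ Λ := hx
    rw [← hS] at h
    have h2 := Submodule.span_toAddSubgroup_eq_closure (R := R) (S : Set A)
    change D.ι x ∈ (Submodule.span R (S : Set A)).toAddSubgroup
    rw [h2]
    exact h
  have hfg : (Subalgebra.toSubmodule B).FG :=
    Submodule.fg_of_fg_map_injective f hf (isNoetherian_submodule.1 hN _ hle)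
  have hint : IsIntegral R c := IsIntegral.of_mem_of_fg B hfg c hc
  obtain ⟨r, hr⟩ := IsIntegrallyClosed.isIntegral_iff.1 hint
  exact ⟨r, by rw [φ_apply, hr]⟩

theorem IsGrOrder.exists_φ_eq_proj_one [IsDedekindDomain R] [IsFractionRing R K]
    (hΛ : D.IsGrOrder Λ) {x : A} (hx : x ∈ Λ) : ∃ r, D.φ r = D.proj 1 x := by
  have := hΛ.graded.proj_mem D 1 hx
  rw [proj_one_apply] at this ⊢
  exact hΛ.exists_φ_eq_ι this

theorem IsFrac.exists_contraction (hΛ : D.IsGrOrder Λ) (hM : D.IsFrac Λ M) :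
    ∃ a : Ideal R, ∀ r, r ∈ a ↔ D.φ r ∈ M :=
  ⟨{ carrier := {r | D.φ r ∈ M}
     add_mem' := fun {r s} hr hs => by
       change D.φ (r + s) ∈ M
       rw [map_add]; exact M.add_mem hr hs
     zero_mem' := by change D.φ 0 ∈ M; rw [map_zero]; exact M.zero_mem
     smul_mem' := fun r s hs => by
       change D.φ (r * s) ∈ M
       rw [map_mul]; exact hM.mul_mem_left _ (hΛ.φ_mem r) _ hs }, fun _ => Iff.rfl⟩

variable (D) in
/-- The image in `A` of an ideal of `R`. -/
def ofIdeal (J : Ideal R) : AddSubgroup A := J.toAddSubgroup.map D.φ.toAddMonoidHom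

theorem isGraded_ofIdeal (J : Ideal R) : D.IsGraded (D.ofIdeal J) := by
  rw [isGraded_iff]
  rintro g _ ⟨r, hr, rfl⟩
  change D.proj g (D.φ r) ∈ _
  by_cases h : g = 1
  · rw [h, proj_one_φ]; exact ⟨r, hr, rfl⟩
  · rw [← D.proj_one_φ, proj_proj_of_ne _ h]; exact zero_mem _

theorem IsGrOrder.ofIdeal_le (hΛ : D.IsGrOrder Λ) (J : Ideal R) : D.ofIdeal J ≤ Λ := by
  rintro _ ⟨r, -, rfl⟩
  exact hΛ.φ_mem r

/-! ### Ideals generated by graded subgroups -/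

/-- The two-sided ideal generated by `X` and the two-sided ideal `P`. -/
def genIdeal (Λ P X : AddSubgroup A) : AddSubgroup A := Λ * (X * Λ) ⊔ P

theorem IsGrOrder.le_genIdeal (hΛ : D.IsGrOrder Λ) (P X : AddSubgroup A) :
    X ≤ genIdeal Λ P X := by
  intro x hx
  refine AddSubgroup.mem_sup_left ?_
  simpa using AddSubgroup.mul_mem_mul hΛ.one_mem (AddSubgroup.mul_mem_mul hx hΛ.one_mem)

theorem genIdeal_le {X L : AddSubgroup A} :
    genIdeal Λ P X ≤ L ↔ (∀ a ∈ Λ, ∀ x ∈ X, ∀ b ∈ Λ, a * (x * b) ∈ L) ∧ P ≤ L := by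
  rw [genIdeal, sup_le_iff]
  refine and_congr_left fun _ => ?_
  rw [AddSubgroup.mul_le]
  refine forall₂_congr fun a _ => ?_
  exact AddSubgroup.mul_le (M := X) (N := Λ) (L := L.comap (AddMonoidHom.mulLeft a))

theorem IsFrac.genIdeal (hΛ : D.IsGrOrder Λ) (hP : D.IsFrac Λ P) (hle : P ≤ Λ)
    {X : AddSubgroup A} (hX : D.IsGraded X) (hXΛ : X ≤ Λ) :
    D.IsFrac Λ (genIdeal Λ P X) where
  graded := (hΛ.graded.mul D (hX.mul D hΛ.graded)).sup D hP.graded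
  mul_mem_left c hc := by
    change CrystallineGradedRing.genIdeal Λ P X ≤
      (CrystallineGradedRing.genIdeal Λ P X).comap (AddMonoidHom.mulLeft c)
    refine genIdeal_le.2 ⟨fun a ha x hx b hb => ?_, fun p hp => ?_⟩
    · refine AddSubgroup.mem_sup_left ?_
      change c * (a * (x * b)) ∈ _
      rw [← mul_assoc]
      exact AddSubgroup.mul_mem_mul (hΛ.mul_mem c hc a ha) (AddSubgroup.mul_mem_mul hx hb)
    · exact AddSubgroup.mem_sup_right (hP.mul_mem_left c hc p hp)
  mul_mem_right c hc := by
    change CrystallineGradedRing.genIdeal Λ P X ≤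
      (CrystallineGradedRing.genIdeal Λ P X).comap (AddMonoidHom.mulRight c)
    refine genIdeal_le.2 ⟨fun a ha x hx b hb => ?_, fun p hp => ?_⟩
    · refine AddSubgroup.mem_sup_left ?_
      change a * (x * b) * c ∈ _
      rw [mul_assoc, mul_assoc x]
      exact AddSubgroup.mul_mem_mul ha (AddSubgroup.mul_mem_mul hx (hΛ.mul_mem b hb c hc))
    · exact AddSubgroup.mem_sup_right (hP.mul_mem_right c hc p hp)
  scal_le := by
    obtain ⟨z, hz, h⟩ := hP.scal_le
    exact ⟨z, hz, fun x hx => AddSubgroup.mem_sup_right (h x hx)⟩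
  le_scal := by
    refine ⟨1, IsScal.one, fun y hy => ?_⟩
    rw [one_mul]
    revert y
    change _ ≤ Λ
    exact genIdeal_le.2 ⟨fun a ha x hx b hb =>
      hΛ.mul_mem _ ha _ (hΛ.mul_mem _ (hXΛ hx) _ hb), hle⟩

theorem IsGrOrder.genIdeal_le_self (hΛ : D.IsGrOrder Λ) (hle : P ≤ Λ)
    {X : AddSubgroup A} (hXΛ : X ≤ Λ) : CrystallineGradedRing.genIdeal Λ P X ≤ Λ :=
  genIdeal_le.2 ⟨fun _ ha _ hx _ hb =>
      hΛ.mul_mem _ ha _ (hΛ.mul_mem _ (hXΛ hx) _ hb), hle⟩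

/-! ### gr-prime Ideals are maximal -/

theorem IsGrPrime.one_notMem (hP : D.IsGrPrime Λ P) : (1 : A) ∉ P := fun h =>
  hP.ne_self (le_antisymm hP.le fun x hx => by simpa using hP.mul_mem_left x hx 1 h)

section Prime

variable [IsDedekindDomain R] [IsFractionRing R K]

theorem IsGrPrime.isFrac (hΛ : D.IsGrOrder Λ) (hP : D.IsGrPrime Λ P) : D.IsFrac Λ P :=
  hP.toIsTwoSidedGrIdeal.isFrac hΛ

/-- Extends primality from Ideals to graded subgroups: $X\Lambda Y\subset P$ gives $(\Lambda
X\Lambda+P)(\Lambda Y\Lambda+P)\subset P$. -/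
theorem IsGrPrime.le_or_le_of_mul_le (hΛ : D.IsGrOrder Λ) (hP : D.IsGrPrime Λ P)
    {X Y : AddSubgroup A} (hX : D.IsGraded X) (hY : D.IsGraded Y) (hXΛ : X ≤ Λ) (hYΛ : Y ≤ Λ)
    (h : ∀ x ∈ X, ∀ a ∈ Λ, ∀ y ∈ Y, x * (a * y) ∈ P) : X ≤ P ∨ Y ≤ P := by
  have hPF := hP.isFrac hΛ
  have := hP.le_or_le _ _
    ((hPF.genIdeal hΛ hP.le hX hXΛ).isTwoSidedGrIdeal hΛ (hΛ.genIdeal_le_self hP.le hXΛ))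
    ((hPF.genIdeal hΛ hP.le hY hYΛ).isTwoSidedGrIdeal hΛ (hΛ.genIdeal_le_self hP.le hYΛ)) ?_
  · exact this.imp (fun h => (hΛ.le_genIdeal _ _).trans h) fun h => (hΛ.le_genIdeal _ _).trans h
  rw [AddSubgroup.mul_le]
  intro m hm n hn
  have key : genIdeal Λ P X ≤ leftTransporter (genIdeal Λ P Y) P := by
    refine genIdeal_le.2 ⟨fun a ha x hx b hb => ?_, fun p hp y hy =>
      hP.mul_mem_right y (hΛ.genIdeal_le_self hP.le hYΛ hy) p hp⟩
    change genIdeal Λ P Y ≤ P.comap (AddMonoidHom.mulLeft (a * (x * b)))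
    refine genIdeal_le.2 ⟨fun c hc y hy d hd => ?_, fun p hp => hP.mul_mem_left _
      (hΛ.mul_mem _ ha _ (hΛ.mul_mem _ (hXΛ hx) _ hb)) p hp⟩
    have h1 := hP.mul_mem_left a ha _
      (hP.mul_mem_right d hd _ (h x hx (b * c) (hΛ.mul_mem b hb c hc) y hy))
    change a * (x * b) * (c * (y * d)) ∈ P
    simpa only [mul_assoc] using h1
  exact key hm n hn

/-- A graded ideal whose component of degree one lies in a gr-prime Ideal is contained in it. -/
theorem IsGrPrime.le_of_proj_one_mem (hΛ : D.IsGrOrder Λ) (hP : D.IsGrPrime Λ P)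
    (hS : D.IsFrac Λ S) (hSΛ : S ≤ Λ) (h : ∀ s ∈ S, D.proj 1 s ∈ P) : S ≤ P := by
  classical
  by_contra hSP
  -- $\{t\in\Lambda \mid tS\subset P\}$ is an Ideal whose product with $S\not\subset P$ lies in $P$,
  -- so it is contained in $P$.
  have hstep : ∀ w ∈ Λ, w ∉ P → ∃ g, ∃ s ∈ S, D.proj g s = s ∧ w * s ∉ P := by
    intro w hw hwP
    by_contra! hcon
    have hT : D.IsFrac Λ (leftTransporter S P ⊓ Λ) :=
      (hS.leftTransporter hΛ (hP.isFrac hΛ)).inf hΛ hΛ.isFrac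
    have := hP.le_or_le _ _ (hT.isTwoSidedGrIdeal hΛ inf_le_right)
      (hS.isTwoSidedGrIdeal hΛ hSΛ) (AddSubgroup.mul_le.2 fun t ht s hs => ht.1 s hs)
    refine hwP ((this.resolve_right hSP) ⟨fun s hs => ?_, hw⟩)
    rw [← D.sum_proj s, Finset.mul_sum]
    exact sum_mem fun g _ => hcon g _ (hS.graded.proj_mem D g hs) (D.proj_proj_self _ _)
  -- Here $w$ is a product of $k$ homogeneous elements of $S$, and $X$ collects the degrees of its
  -- right-hand partial products, which turn out to be distinct.
  have hind : ∀ k : ℕ, ∃ w ∈ Λ, w ∉ P ∧ ∃ X : Finset G, X.card = k ∧ 1 ∉ X ∧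
      ∀ x ∈ X, ∃ a ∈ Λ, ∃ b ∈ S, D.proj x b = b ∧ w = a * b := by
    intro k
    induction k with
    | zero => exact ⟨1, hΛ.one_mem, hP.one_notMem, ∅, by simp⟩
    | succ k ih =>
      obtain ⟨w, hw, hwP, X, hX, h1, hXw⟩ := ih
      obtain ⟨g, s, hs, hgs, hws⟩ := hstep w hw hwP
      -- Appending $s$ of degree $g$ shifts the old degrees by $g$ on the right and adds the new
      -- degree $g=1\cdot g$.
      have hmem : ∀ x ∈ (insert 1 X).map (mulRightEmbedding g),
          ∃ a ∈ Λ, ∃ b ∈ S, D.proj x b = b ∧ w * s = a * b := by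
        intro x hx
        obtain ⟨y, hy, rfl⟩ := Finset.mem_map.1 hx
        rcases Finset.mem_insert.1 hy with rfl | hy
        · exact ⟨w, hw, s, hs, by simpa using hgs, rfl⟩
        · obtain ⟨a, ha, b, hb, hyb, rfl⟩ := hXw y hy
          exact ⟨a, ha, b * s, hS.mul_mem_right s (hSΛ hs) b hb,
            D.proj_mul_of_eq hyb hgs rfl, mul_assoc _ _ _⟩
      refine ⟨w * s, hΛ.mul_mem w hw s (hSΛ hs), hws, _, ?_, fun hmem1 => hws ?_, hmem⟩
      · rw [Finset.card_map, Finset.card_insert_of_notMem h1, hX]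
      -- A right factor of degree $1$ in $S$ would lie in $P$, and then so would $ws$.
      · obtain ⟨a, ha, b, hb, hb1, heq⟩ := hmem 1 hmem1
        rw [heq, ← hb1]
        exact hP.mul_mem_left a ha _ (h b hb)
  obtain ⟨w, -, -, X, hX, -⟩ := hind (Fintype.card G + 1)
  have := X.card_le_univ
  omega

/-- A gr-prime Ideal contains a nonzero radical ideal of `R`. -/
theorem IsGrPrime.exists_isRadical (hΛ : D.IsGrOrder Λ) (hP : D.IsGrPrime Λ P) :
    ∃ c : Ideal R, c.IsRadical ∧ c ≠ ⊥ ∧ D.ofIdeal c ≤ P := by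
  obtain ⟨_, ⟨z, hz0, hz, rfl⟩, hzP⟩ := (hP.isFrac hΛ).scal_le
  have hzP1 : D.φ z ∈ P := by simpa using hzP 1 hΛ.one_mem
  let c := (Ideal.span {z}).radical
  have hzc : z ∈ c := Ideal.le_radical (Ideal.mem_span_singleton_self z)
  refine ⟨c, Ideal.radical_isRadical _, fun h => hz0 (by rw [h] at hzc; exact hzc), ?_⟩
  -- $c$ is the radical of an ideal with an invariant generator, hence $G$-stable; so $c^n\Lambda
  -- c\subset c^{n+1}\Lambda$, and primality lowers the exponent in $c^n\subset P$ to $1$.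
  have hinv : ∀ g : G, ∀ r ∈ c, g • r ∈ c := by
    rintro g r ⟨n, hn⟩
    obtain ⟨t, ht⟩ := Ideal.mem_span_singleton'.1 hn
    refine ⟨n, Ideal.mem_span_singleton'.2 ⟨g • t, ?_⟩⟩
    rw [← smul_pow', ← ht, smul_mul', hz]
  obtain ⟨n, hn⟩ := Ideal.exists_radical_pow_le_of_fg (Ideal.span {z})
    (IsNoetherian.noetherian _)
  have hnP : D.ofIdeal (c ^ n) ≤ P := by
    rintro _ ⟨r, hr, rfl⟩
    obtain ⟨t, rfl⟩ := Ideal.mem_span_singleton'.1 (hn hr)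
    change D.φ (t * z) ∈ P
    rw [map_mul]
    exact hP.left_mem t _ hzP1
  clear hn
  induction n with
  | zero =>
    refine absurd (hnP ⟨1, ?_, map_one D.φ⟩) hP.one_notMem
    rw [pow_zero, Ideal.one_eq_top]
    trivial
  | succ n ih =>
    refine (hP.le_or_le_of_mul_le hΛ (isGraded_ofIdeal (c ^ n)) (isGraded_ofIdeal c)
      (hΛ.ofIdeal_le _) (hΛ.ofIdeal_le _) ?_).elim ih id
    rintro _ ⟨r, hr, rfl⟩ a ha _ ⟨s, hs, rfl⟩
    change D.φ r * (a * D.φ s) ∈ P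
    rw [← D.sum_proj a, Finset.sum_mul, Finset.mul_sum]
    refine sum_mem fun g _ => ?_
    rw [proj_mul_φ_eq, ← mul_assoc, ← map_mul]
    refine hP.mul_mem_right _ (hΛ.graded.proj_mem D g ha) _ (hnP ⟨_, ?_, rfl⟩)
    rw [pow_succ]
    exact Ideal.mul_mem_mul hr (hinv g s hs)

/-- Put $s=S\cap R$ and write $P\cap R=st$; squarefreeness gives $s+t=R$. With $T=\Lambda
t\Lambda+P$, the degree-one part of $ST$ lies in $P$, so $ST\subset P$ and $T\subset P$. Then $S$
contains both $s$ and $t$, hence $1$. -/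
theorem IsGrPrime.eq_of_lt (hΛ : D.IsGrOrder Λ) (hP : D.IsGrPrime Λ P)
    (hS : D.IsTwoSidedGrIdeal Λ S) (hlt : P < S) : S = Λ := by
  have hSF := hS.isFrac hΛ
  have hPF := hP.isFrac hΛ
  obtain ⟨c, hc, hc0, hcP⟩ := hP.exists_isRadical hΛ
  obtain ⟨a, ha⟩ := hPF.exists_contraction hΛ
  obtain ⟨s, hs⟩ := hSF.exists_contraction hΛ
  have hca : a ∣ c := Ideal.dvd_iff_le.2 fun r hr => (ha r).2 (hcP ⟨r, hr, rfl⟩)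
  have hsq : Squarefree a := (Ideal.squarefree_of_isRadical hc hc0).squarefree_of_dvd hca
  obtain ⟨t, rfl⟩ : s ∣ a := Ideal.dvd_iff_le.2 fun r hr => (hs r).2 (hlt.le ((ha r).1 hr))
  have hst : s ⊔ t = ⊤ := by
    have h1 := (squarefree_mul_iff.1 hsq).1 (Ideal.dvd_iff_le.2 le_sup_left :
      s ⊔ t ∣ s) (Ideal.dvd_iff_le.2 le_sup_right)
    exact Ideal.isUnit_iff.1 h1
  have hrad : ∀ q : R, D.φ q * D.φ q ∈ P → D.φ q ∈ P := by
    intro q hq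
    rw [← map_mul, ← ha] at hq
    rw [← ha]
    have h2 : s * t ∣ Ideal.span {q} ^ 2 := by
      rw [Ideal.dvd_iff_le, pow_two, Ideal.span_singleton_mul_span_singleton,
        Ideal.span_singleton_le_iff_mem]
      exact hq
    have := hsq.isRadical 2 _ h2
    rwa [Ideal.dvd_iff_le, Ideal.span_singleton_le_iff_mem] at this
  have hT := hPF.genIdeal hΛ hP.le (isGraded_ofIdeal t) (hΛ.ofIdeal_le t)
  have hTΛ := hΛ.genIdeal_le_self hP.le (hΛ.ofIdeal_le (D := D) t)
  have hproj : ∀ x ∈ S * genIdeal Λ P (D.ofIdeal t), D.proj 1 x ∈ P := by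
    change _ ≤ P.comap (D.proj 1)
    refine AddSubgroup.mul_le.2 fun m hm => ?_
    change genIdeal Λ P (D.ofIdeal t) ≤ (P.comap (D.proj 1)).comap (AddMonoidHom.mulLeft m)
    refine genIdeal_le.2 ⟨?_, fun p hp => hP.graded.proj_mem D 1
      (hP.mul_mem_left m (hS.le hm) p hp)⟩
    rintro x hx _ ⟨f, hf, rfl⟩ y hy
    change D.proj 1 (m * (x * (D.φ f * y))) ∈ P
    have hmx : m * x ∈ S := hS.mul_mem_right x hx m hm
    rw [← mul_assoc, ← mul_assoc, proj_mul]
    refine sum_mem fun g _ => ?_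
    rw [proj_mul_φ]
    have hs' := hS.graded.proj_mem D g hmx
    have hy' := hΛ.graded.proj_mem D (g⁻¹ * 1) hy
    have hgs := D.proj_proj_self g (m * x)
    have hgy := D.proj_proj_self (g⁻¹ * 1) y
    generalize D.proj g (m * x) = s' at *
    generalize D.proj (g⁻¹ * 1) y = y' at *
    have hys : y' * s' ∈ S := hS.mul_mem_left _ hy' _ hs'
    obtain ⟨r, hr⟩ := hΛ.exists_φ_eq_proj_one (hS.le hys)
    rw [D.proj_mul_of_eq hgy hgs (by group)] at hr
    -- $y's'$ has degree one and lies in $S$, so it comes from $s$; multiplying by $f\in t$ lands in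
    -- $st=P\cap R$.
    have hrf : y' * s' * D.φ f ∈ P := by
      rw [← hr, ← map_mul, ← ha]
      exact Ideal.mul_mem_mul ((hs r).2 (hr ▸ hys)) hf
    have hsf : s' * D.φ f ∈ S := hS.right_mem f _ hs'
    obtain ⟨q, hq⟩ := hΛ.exists_φ_eq_proj_one (hΛ.mul_mem _ (hS.le hsf) _ hy')
    rw [D.proj_mul_of_eq (g := g) (h := g⁻¹ * 1) (by rw [proj_mul_φ, hgs]) hgy (by group)] at hq
    rw [← hq]
    -- The wanted element is $q=s'fy'\in R$, and $q^2=(s'f)(y's'f)y'$ lies in $P$; since $P\cap R$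
    -- is radical, so does $q$.
    refine hrad q ?_
    rw [hq]
    have := hP.mul_mem_left _ (hS.le hsf) _ (hP.mul_mem_right _ hy' _ hrf)
    simpa only [mul_assoc] using this
  have hle := hP.le_of_proj_one_mem hΛ (hSF.mul hΛ hT)
    (AddSubgroup.mul_le.2 fun x hx y hy => hΛ.mul_mem _ (hS.le hx) _ (hTΛ hy)) hproj
  have htP : D.ofIdeal t ≤ P := (hΛ.le_genIdeal _ _).trans
    ((hP.le_or_le _ _ hS (hT.isTwoSidedGrIdeal hΛ hTΛ) hle).resolve_left hlt.not_ge)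
  have h1 : (1 : R) ∈ s ⊔ t := by rw [hst]; trivial
  obtain ⟨e, he, f, hf, hef⟩ := Submodule.mem_sup.1 h1
  have h1S : (1 : A) ∈ S := by
    rw [← map_one D.φ, ← hef, map_add]
    exact S.add_mem ((hs e).1 he) (hlt.le (htP ⟨f, hf, rfl⟩))
  exact le_antisymm hS.le fun x hx => by simpa using hS.mul_mem_left x hx 1 h1S

end Prime

end CrystallineGradedRing

namespace CrystallineGradedRing

variable {R K G A : Type*} [CommRing R] [Field K] [Algebra R K]
  [Group G] [Fintype G] [MulSemiringAction G R] [Ring A]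
  {D : CrystallineGradedRing R K G A} {Λ M N P Q S T : AddSubgroup A}

/-! ### Arithmetic of Ideals -/

theorem IsFrac.order_mul (hΛ : D.IsGrOrder Λ) (hM : D.IsFrac Λ M) : Λ * M = M :=
  le_antisymm (AddSubgroup.mul_le.2 hM.mul_mem_left) fun m hm => by
    simpa using AddSubgroup.mul_mem_mul hΛ.one_mem hm

theorem IsFrac.mul_order (hΛ : D.IsGrOrder Λ) (hM : D.IsFrac Λ M) : M * Λ = M :=
  le_antisymm (AddSubgroup.mul_le.2 fun m hm x hx => hM.mul_mem_right x hx m hm) fun m hm => by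
    simpa using AddSubgroup.mul_mem_mul hm hΛ.one_mem

theorem IsTwoSidedGrIdeal.mul_le_left (hM : D.IsTwoSidedGrIdeal Λ M) (hN : N ≤ Λ) : M * N ≤ M :=
  AddSubgroup.mul_le.2 fun m hm n hn => hM.mul_mem_right n (hN hn) m hm

theorem IsTwoSidedGrIdeal.mul_le_right (hM : D.IsTwoSidedGrIdeal Λ M) (hN : N ≤ Λ) : N * M ≤ M :=
  AddSubgroup.mul_le.2 fun n hn m hm => hM.mul_mem_left n (hN hn) m hm

theorem IsTwoSidedGrIdeal.eq_of_one_mem (hM : D.IsTwoSidedGrIdeal Λ M) (h : (1 : A) ∈ M) :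
    M = Λ :=
  le_antisymm hM.le fun x hx => by simpa using hM.mul_mem_left x hx 1 h

theorem IsGrOrder.wellFounded [IsNoetherianRing R] (hΛ : D.IsGrOrder Λ) :
    WellFounded fun N N' : {N // D.IsTwoSidedGrIdeal Λ N} => N' < N := by
  let _ : Module R A := Module.compHom A D.φ
  exact wellFounded_gt_of_closure_eq (R := R) hΛ.left_fg _ fun N hN => ⟨hN.le, hN.left_mem⟩

/-- Noetherian induction on two-sided graded Ideals. -/
theorem IsTwoSidedGrIdeal.induction [IsNoetherianRing R] (hΛ : D.IsGrOrder Λ)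
    {p : AddSubgroup A → Prop}
    (h : ∀ M, D.IsTwoSidedGrIdeal Λ M → (∀ N, D.IsTwoSidedGrIdeal Λ N → M < N → p N) → p M)
    (hM : D.IsTwoSidedGrIdeal Λ M) : p M :=
  hΛ.wellFounded.induction (C := fun N => p N.1) ⟨M, hM⟩ fun N ih =>
    h N.1 N.2 fun N' hN' hlt => ih ⟨N', hN'⟩ hlt

section

variable [IsDedekindDomain R] [IsFractionRing R K]

theorem IsTwoSidedGrIdeal.mul (hΛ : D.IsGrOrder Λ) (hM : D.IsTwoSidedGrIdeal Λ M)
    (hN : D.IsTwoSidedGrIdeal Λ N) : D.IsTwoSidedGrIdeal Λ (M * N) :=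
  ((hM.isFrac hΛ).mul hΛ (hN.isFrac hΛ)).isTwoSidedGrIdeal hΛ
    ((hM.mul_le_left hN.le).trans hM.le)

theorem IsTwoSidedGrIdeal.sup (hΛ : D.IsGrOrder Λ) (hM : D.IsTwoSidedGrIdeal Λ M)
    (hN : D.IsTwoSidedGrIdeal Λ N) : D.IsTwoSidedGrIdeal Λ (M ⊔ N) :=
  ((hM.isFrac hΛ).sup hΛ (hN.isFrac hΛ)).isTwoSidedGrIdeal hΛ (sup_le hM.le hN.le)

theorem IsGrOrder.isTwoSidedGrIdeal (hΛ : D.IsGrOrder Λ) : D.IsTwoSidedGrIdeal Λ Λ :=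
  hΛ.isFrac.isTwoSidedGrIdeal hΛ le_rfl

theorem IsTwoSidedGrIdeal.isGrPrime_of_maximal (hΛ : D.IsGrOrder Λ)
    (hM : D.IsTwoSidedGrIdeal Λ M) (hne : M ≠ Λ)
    (hmax : ∀ N, D.IsTwoSidedGrIdeal Λ N → M < N → N = Λ) : D.IsGrPrime Λ M := by
  refine ⟨hM, hne, fun S T hS hT hST => ?_⟩
  by_contra! hcon
  have hS' := hmax _ (hS.sup hΛ hM) (right_lt_sup.2 hcon.1)
  have hT' := hmax _ (hT.sup hΛ hM) (right_lt_sup.2 hcon.2)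
  have h1 := hΛ.one_mem
  have h2 := hΛ.one_mem
  rw [← hS'] at h1
  rw [← hT'] at h2
  obtain ⟨s, hs, p, hp, h1⟩ := AddSubgroup.mem_sup.1 h1
  obtain ⟨t, ht, q, hq, h2⟩ := AddSubgroup.mem_sup.1 h2
  refine hne (hM.eq_of_one_mem ?_)
  have h3 : (1 : A) = s * t + s * q + p * 1 := by
    rw [← mul_add, h2, mul_one, mul_one, h1]
  rw [h3]
  exact M.add_mem (M.add_mem (hST (AddSubgroup.mul_mem_mul hs ht))
    (hM.mul_mem_left s (hS.le hs) q hq)) (by rwa [mul_one])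

theorem IsTwoSidedGrIdeal.exists_isGrPrime_ge (hΛ : D.IsGrOrder Λ)
    (hM : D.IsTwoSidedGrIdeal Λ M) (hne : M ≠ Λ) : ∃ P, D.IsGrPrime Λ P ∧ M ≤ P := by
  revert hne
  refine IsTwoSidedGrIdeal.induction hΛ (p := fun M => M ≠ Λ → ∃ P, D.IsGrPrime Λ P ∧ M ≤ P)
    (fun M hM ih hne => ?_) hM
  by_cases hmax : ∀ N, D.IsTwoSidedGrIdeal Λ N → M < N → N = Λ
  · exact ⟨M, hM.isGrPrime_of_maximal hΛ hne hmax, le_rfl⟩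
  · push Not at hmax
    obtain ⟨N, hN, hlt, hNe⟩ := hmax
    obtain ⟨P, hP, hle⟩ := ih N hN hlt hNe
    exact ⟨P, hP, hlt.le.trans hle⟩

theorem IsGrPrime.eq_of_le (hΛ : D.IsGrOrder Λ) (hP : D.IsGrPrime Λ P) (hQ : D.IsGrPrime Λ Q)
    (h : P ≤ Q) : P = Q := by
  by_contra hne
  exact hQ.ne_self (hP.eq_of_lt hΛ hQ.toIsTwoSidedGrIdeal (lt_of_le_of_ne h hne))

theorem isTwoSidedGrIdeal_idealProd (hΛ : D.IsGrOrder Λ) {l : List (AddSubgroup A)}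
    (hl : ∀ P ∈ l, D.IsGrPrime Λ P) : D.IsTwoSidedGrIdeal Λ (idealProd Λ l) := by
  induction l with
  | nil => exact hΛ.isTwoSidedGrIdeal
  | cons P l ih =>
    exact (hl P (by simp)).toIsTwoSidedGrIdeal.mul hΛ (ih fun Q hQ => hl Q (by simp [hQ]))

theorem idealProd_cons (P : AddSubgroup A) (l : List (AddSubgroup A)) :
    idealProd Λ (P :: l) = P * idealProd Λ l := rfl

theorem idealProd_append (hΛ : D.IsGrOrder Λ) {l l' : List (AddSubgroup A)}
    (hl' : ∀ P ∈ l', D.IsGrPrime Λ P) :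
    idealProd Λ (l ++ l') = idealProd Λ l * idealProd Λ l' := by
  induction l with
  | nil => exact (((isTwoSidedGrIdeal_idealProd hΛ hl').isFrac hΛ).order_mul hΛ).symm
  | cons P l ih =>
    rw [List.cons_append, idealProd_cons, idealProd_cons, ih, AddSubgroup.mul_assoc]

/-- Primality puts some factor inside $P$, and maximality of gr-primes turns this inclusion into
equality. -/
theorem IsGrPrime.mem_of_idealProd_le (hΛ : D.IsGrOrder Λ) (hP : D.IsGrPrime Λ P)
    {l : List (AddSubgroup A)} (hl : ∀ Q ∈ l, D.IsGrPrime Λ Q) (h : idealProd Λ l ≤ P) :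
    P ∈ l := by
  induction l with
  | nil => exact absurd (h hΛ.one_mem) hP.one_notMem
  | cons Q l ih =>
    have hQ := hl Q (by simp)
    have hl' : ∀ Q ∈ l, D.IsGrPrime Λ Q := fun Q hQ => hl Q (by simp [hQ])
    rcases hP.le_or_le _ _ hQ.toIsTwoSidedGrIdeal (isTwoSidedGrIdeal_idealProd hΛ hl') h with h | h
    · rw [hQ.eq_of_le hΛ hP h]; simp
    · exact List.mem_cons_of_mem _ (ih hl' h)

theorem IsTwoSidedGrIdeal.exists_idealProd_le (hΛ : D.IsGrOrder Λ)
    (hM : D.IsTwoSidedGrIdeal Λ M) :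
    ∃ l : List (AddSubgroup A), (∀ P ∈ l, D.IsGrPrime Λ P) ∧ idealProd Λ l ≤ M := by
  refine IsTwoSidedGrIdeal.induction hΛ (p := fun M => ∃ l : List (AddSubgroup A),
    (∀ P ∈ l, D.IsGrPrime Λ P) ∧ idealProd Λ l ≤ M) (fun M hM ih => ?_) hM
  by_cases hne : M = Λ
  · exact ⟨[], by simp, hne.ge⟩
  by_cases hP : D.IsGrPrime Λ M
  · exact ⟨[M], by simpa using hP, hM.mul_le_left le_rfl⟩
  have : ∃ S T, D.IsTwoSidedGrIdeal Λ S ∧ D.IsTwoSidedGrIdeal Λ T ∧ S * T ≤ M ∧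
      ¬ S ≤ M ∧ ¬ T ≤ M := by
    by_contra! hcon
    refine hP ⟨hM, hne, fun S T hS hT hST => ?_⟩
    by_contra! h
    exact h.2 (hcon S T hS hT hST h.1)
  obtain ⟨S, T, hS, hT, hST, hSM, hTM⟩ := this
  obtain ⟨l, hl, hlS⟩ := ih _ (hS.sup hΛ hM) (right_lt_sup.2 hSM)
  obtain ⟨l', hl', hlT⟩ := ih _ (hT.sup hΛ hM) (right_lt_sup.2 hTM)
  refine ⟨l ++ l', fun P hP => (List.mem_append.1 hP).elim (hl P) (hl' P), ?_⟩
  rw [idealProd_append hΛ hl', AddSubgroup.mul_le]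
  intro x hx y hy
  obtain ⟨s, hs, p, hp, rfl⟩ := AddSubgroup.mem_sup.1 (hlS hx)
  obtain ⟨t, ht, q, hq, rfl⟩ := AddSubgroup.mem_sup.1 (hlT hy)
  rw [add_mul, mul_add]
  exact M.add_mem (M.add_mem (hST (AddSubgroup.mul_mem_mul hs ht))
    (hM.mul_mem_left s (hS.le hs) q hq))
    (hM.mul_mem_right _ (Λ.add_mem (hT.le ht) (hM.le hq)) p hp)

/-! ### Invertibility -/

theorem IsGrPrime.not_latticeInv_le (hΛ : D.IsGrMaximalOrder Λ) (hP : D.IsGrPrime Λ P) :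
    ¬ latticeInv P ≤ Λ := by
  classical
  intro hinv
  have hO := hΛ.prop
  obtain ⟨z, hz, hzP⟩ := (hP.isFrac hO).scal_le
  let Z : AddSubgroup A := Λ.map (AddMonoidHom.mulLeft z)
  have hZ : D.IsTwoSidedGrIdeal Λ Z := by
    refine IsFrac.isTwoSidedGrIdeal hO ⟨?_, ?_, ?_, ⟨z, hz, fun x hx => ⟨x, hx, rfl⟩⟩,
      ⟨1, IsScal.one, ?_⟩⟩ ?_
    · rw [isGraded_iff]
      rintro g _ ⟨y, hy, rfl⟩
      obtain ⟨r, -, -, rfl⟩ := hz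
      exact ⟨_, hO.graded.proj_mem D g hy, (D.proj_φ_mul g r y).symm⟩
    · rintro x hx _ ⟨y, hy, rfl⟩
      refine ⟨x * y, hO.mul_mem x hx y hy, ?_⟩
      change z * (x * y) = x * (z * y)
      rw [← mul_assoc, hz.commute, mul_assoc]
    · rintro x hx _ ⟨y, hy, rfl⟩
      exact ⟨y * x, hO.mul_mem y hy x hx, (mul_assoc z y x).symm⟩
    · rintro _ ⟨y, hy, rfl⟩
      rw [one_mul]
      exact hO.mul_mem z (hO.scal_mem hz) y hy
    · rintro _ ⟨y, hy, rfl⟩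
      exact hO.mul_mem z (hO.scal_mem hz) y hy
  have hex : ∃ n, ∃ l : List (AddSubgroup A), l.length = n ∧ (∀ P ∈ l, D.IsGrPrime Λ P) ∧
      idealProd Λ l ≤ Z := by
    obtain ⟨l, hl, hle⟩ := hZ.exists_idealProd_le hO
    exact ⟨_, l, rfl, hl, hle⟩
  -- A shortest product of gr-primes inside $z\Lambda\subset P$; one of its factors is $P$.
  obtain ⟨l, hlen, hl, hle⟩ := Nat.find_spec hex
  have hZP : Z ≤ P := by
    rintro _ ⟨y, hy, rfl⟩
    exact hzP y hy
  obtain ⟨l₁, l₂, rfl⟩ := List.append_of_mem (hP.mem_of_idealProd_le hO hl (hle.trans hZP))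
  have hl₁ : ∀ P ∈ l₁, D.IsGrPrime Λ P := fun Q hQ => hl Q (by simp [hQ])
  have hl₂ : ∀ P ∈ l₂, D.IsGrPrime Λ P := fun Q hQ => hl Q (by simp [hQ])
  rw [idealProd_append hO (fun Q hQ => hl Q (List.mem_append_right _ hQ)), idealProd_cons] at hle
  have hlt : (l₂ ++ l₁).length < Nat.find hex := by
    rw [← hlen]
    simp only [List.length_append, List.length_cons]
    omega
  -- From $BPC\subset z\Lambda$ the aim is $CB\subset z\Lambda$: the factors around $P$ are rotated,
  -- since nothing is known yet to commute. This contradicts minimality.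
  refine Nat.find_min hex hlt ⟨l₂ ++ l₁, rfl, fun Q hQ => ?_, ?_⟩
  · exact (List.mem_append.1 hQ).elim (hl₂ Q) (hl₁ Q)
  rw [idealProd_append hO hl₁]
  have hB := isTwoSidedGrIdeal_idealProd hO hl₁
  have hC := isTwoSidedGrIdeal_idealProd hO hl₂
  generalize idealProd Λ l₁ = B at *
  generalize idealProd Λ l₂ = C at *
  obtain ⟨y, hyz, hzy⟩ := hz.exists_inv
  intro x hx
  refine ⟨y * x, hinv ?_, ?_⟩
  · rw [hΛ.latticeInv_eq_right (hP.isFrac hO)]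
    intro p hp
    rw [← hΛ.rightTransporter_self (hB.isFrac hO)]
    intro b hb
    -- With $y=z^{-1}$ central, $bpc\in z\Lambda$ gives $(bpy)(cb')=(bpcy)b'\in\Lambda B\subset B$.
    -- So $pyx$ is in the right multiplier ring $\Lambda$ of $B$ for $x\in CB$, whence $yx\in
    -- P^{-1}\subset\Lambda$.
    have key : C * B ≤ B.comap (AddMonoidHom.mulLeft (b * (p * y))) := by
      refine AddSubgroup.mul_le.2 fun c hc b' hb' => ?_
      obtain ⟨v, hv, hvz⟩ := hle (AddSubgroup.mul_mem_mul hb (AddSubgroup.mul_mem_mul hp hc))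
      replace hvz : z * v = b * (p * c) := hvz
      change b * (p * y) * (c * b') ∈ B
      have hyc : y * c = c * y := by
        calc y * c = y * c * (z * y) := by rw [hzy, mul_one]
          _ = y * (c * z) * y := by simp only [mul_assoc]
          _ = c * y := by rw [← hz.commute, ← mul_assoc, hyz, one_mul]
      have hyv : z * v * y = v := by rw [hz.commute, mul_assoc, hzy, mul_one]
      have : b * (p * y) * (c * b') = v * b' := by
        calc b * (p * y) * (c * b') = b * (p * (y * c)) * b' := by simp only [mul_assoc]
          _ = b * (p * c) * y * b' := by rw [hyc]; simp only [mul_assoc]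
          _ = v * b' := by rw [← hvz, hyv]
      rw [this]
      exact hB.mul_mem_left v hv b' hb'
    have := key hx
    change b * (p * y) * x ∈ B at this
    simpa only [mul_assoc] using this
  · change z * (y * x) = x
    rw [← mul_assoc, hzy, one_mul]

theorem IsTwoSidedGrIdeal.not_latticeInv_le (hΛ : D.IsGrMaximalOrder Λ)
    (hM : D.IsTwoSidedGrIdeal Λ M) (hne : M ≠ Λ) : ¬ latticeInv M ≤ Λ := by
  obtain ⟨P, hP, hMP⟩ := hM.exists_isGrPrime_ge hΛ.prop hne
  refine fun h => hP.not_latticeInv_le hΛ (le_trans ?_ h)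
  rw [hΛ.latticeInv_eq_left (hP.isFrac hΛ.prop), hΛ.latticeInv_eq_left (hM.isFrac hΛ.prop)]
  exact fun x hx m hm => hx m (hMP hm)

/-- Let $J=MM^{-1}$. If $Jx\subset\Lambda$, then $M^{-1}x\subset M^{-1}$, so $x$ is in the right
multiplier ring $\Lambda$ of $M^{-1}$. Thus $J^{-1}\subset\Lambda$, which is impossible for a proper
Ideal. -/
theorem IsFrac.mul_latticeInv (hΛ : D.IsGrMaximalOrder Λ) (hM : D.IsFrac Λ M) :
    M * latticeInv M = Λ := by
  have hO := hΛ.prop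
  have hI := hΛ.isFrac_latticeInv hM
  have hr := hΛ.latticeInv_eq_right hM
  have hJ : D.IsTwoSidedGrIdeal Λ (M * latticeInv M) :=
    (hM.mul hO hI).isTwoSidedGrIdeal hO (AddSubgroup.mul_le.2 fun m hm x hx => by
      rw [hr] at hx
      exact hx m hm)
  by_contra hne
  refine hJ.not_latticeInv_le hΛ hne fun x hx => ?_
  rw [hΛ.latticeInv_eq_right (hJ.isFrac hO)] at hx
  rw [← hΛ.rightTransporter_self hI]
  intro y hy
  rw [hr]
  intro m hm
  rw [← mul_assoc]
  exact hx _ (AddSubgroup.mul_mem_mul hm hy)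

theorem IsFrac.latticeInv_mul (hΛ : D.IsGrMaximalOrder Λ) (hM : D.IsFrac Λ M) :
    latticeInv M * M = Λ := by
  have hO := hΛ.prop
  have hI := hΛ.isFrac_latticeInv hM
  have hr := hΛ.latticeInv_eq_left hM
  have hJ : D.IsTwoSidedGrIdeal Λ (latticeInv M * M) :=
    (hI.mul hO hM).isTwoSidedGrIdeal hO (AddSubgroup.mul_le.2 fun x hx m hm => by
      rw [hr] at hx
      exact hx m hm)
  by_contra hne
  refine hJ.not_latticeInv_le hΛ hne fun x hx => ?_
  rw [hΛ.latticeInv_eq_left (hJ.isFrac hO)] at hx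
  rw [← hΛ.leftTransporter_self hI]
  intro y hy
  rw [hr]
  intro m hm
  rw [mul_assoc]
  exact hx _ (AddSubgroup.mul_mem_mul hy hm)

theorem IsFrac.latticeInv_latticeInv (hΛ : D.IsGrMaximalOrder Λ) (hM : D.IsFrac Λ M) :
    latticeInv (latticeInv M) = M := by
  have hO := hΛ.prop
  have hI := hΛ.isFrac_latticeInv hM
  have hII := hΛ.isFrac_latticeInv hI
  rw [← hII.mul_order hO, ← hM.latticeInv_mul hΛ, ← AddSubgroup.mul_assoc, hI.latticeInv_mul hΛ,
    hM.order_mul hO]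

/-! ### Factorization -/

theorem IsFrac.mul_left_cancel (hΛ : D.IsGrMaximalOrder Λ) (hM : D.IsFrac Λ M)
    (hS : D.IsFrac Λ S) (hT : D.IsFrac Λ T) (h : M * S = M * T) : S = T := by
  rw [← hS.order_mul hΛ.prop, ← hT.order_mul hΛ.prop, ← hM.latticeInv_mul hΛ,
    AddSubgroup.mul_assoc, AddSubgroup.mul_assoc, h]

/-- An Ideal contained in `M` is a multiple of `M`. -/
theorem IsTwoSidedGrIdeal.exists_eq_mul_of_le (hΛ : D.IsGrMaximalOrder Λ)
    (hM : D.IsTwoSidedGrIdeal Λ M) (hN : D.IsTwoSidedGrIdeal Λ N) (h : N ≤ M) :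
    ∃ S, D.IsTwoSidedGrIdeal Λ S ∧ N = M * S := by
  have hMF := hM.isFrac hΛ.prop
  have hNF := hN.isFrac hΛ.prop
  refine ⟨latticeInv M * N, IsFrac.isTwoSidedGrIdeal hΛ.prop
    ((hΛ.isFrac_latticeInv hMF).mul hΛ.prop hNF) ?_, ?_⟩
  · rw [← hMF.latticeInv_mul hΛ]
    exact AddSubgroup.mul_le_mul le_rfl h
  · rw [← AddSubgroup.mul_assoc, hMF.mul_latticeInv hΛ, hNF.order_mul hΛ.prop]

/-- Write $P\cap Q=PS$. As $PS\subset Q$ and $P\not\subset Q$, primality of $Q$ gives $S\subset Q$.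
Used in both orders, this yields commutation. -/
theorem IsGrPrime.inf_le_mul (hΛ : D.IsGrMaximalOrder Λ) (hP : D.IsGrPrime Λ P)
    (hQ : D.IsGrPrime Λ Q) (hne : P ≠ Q) : P ⊓ Q ≤ P * Q := by
  have hO := hΛ.prop
  obtain ⟨S, hS, h⟩ := hP.toIsTwoSidedGrIdeal.exists_eq_mul_of_le hΛ
    (((hP.isFrac hO).inf hO (hQ.isFrac hO)).isTwoSidedGrIdeal hO (inf_le_left.trans hP.le))
    inf_le_left
  have hSQ : S ≤ Q := (hQ.le_or_le _ _ hP.toIsTwoSidedGrIdeal hS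
    (h ▸ inf_le_right)).resolve_left fun hle => hne (hP.eq_of_le hO hQ hle)
  rw [h]
  exact AddSubgroup.mul_le_mul le_rfl hSQ

theorem IsGrPrime.mul_comm (hΛ : D.IsGrMaximalOrder Λ) (hP : D.IsGrPrime Λ P)
    (hQ : D.IsGrPrime Λ Q) : P * Q = Q * P := by
  by_cases hne : P = Q
  · rw [hne]
  refine le_antisymm (le_trans (le_inf (hQ.mul_le_right hP.le) (hP.mul_le_left hQ.le))
    (hQ.inf_le_mul hΛ hP (Ne.symm hne)))
    (le_trans (le_inf (hP.mul_le_right hQ.le) (hQ.mul_le_left hP.le)) (hP.inf_le_mul hΛ hQ hne))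

theorem IsTwoSidedGrIdeal.exists_idealProd_eq (hΛ : D.IsGrMaximalOrder Λ)
    (hM : D.IsTwoSidedGrIdeal Λ M) :
    ∃ l : List (AddSubgroup A), (∀ P ∈ l, D.IsGrPrime Λ P) ∧ idealProd Λ l = M := by
  have hO := hΛ.prop
  refine IsTwoSidedGrIdeal.induction hO (p := fun M => ∃ l : List (AddSubgroup A),
    (∀ P ∈ l, D.IsGrPrime Λ P) ∧ idealProd Λ l = M) (fun M hM ih => ?_) hM
  by_cases hne : M = Λ
  · exact ⟨[], by simp, hne.symm⟩
  obtain ⟨P, hP, hMP⟩ := hM.exists_isGrPrime_ge hO hne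
  obtain ⟨S, hS, rfl⟩ := hP.toIsTwoSidedGrIdeal.exists_eq_mul_of_le hΛ hM hMP
  -- If $PS=S$, cancelling the invertible $S$ would give $P=\Lambda$.
  have hlt : P * S < S := by
    refine lt_of_le_of_ne (hS.mul_le_right hP.le) fun h => hP.one_notMem ?_
    have hSF := hS.isFrac hO
    have h2 : P * Λ = Λ := by
      rw [← hSF.mul_latticeInv hΛ, ← AddSubgroup.mul_assoc, h]
    rw [(hP.isFrac hO).mul_order hO] at h2
    rw [h2]
    exact hO.one_mem
  obtain ⟨l, hl, rfl⟩ := ih S hS hlt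
  refine ⟨P :: l, fun Q hQ => ?_, rfl⟩
  rcases List.mem_cons.1 hQ with rfl | hQ
  exacts [hP, hl Q hQ]

theorem idealProd_perm (hΛ : D.IsGrMaximalOrder Λ) {l l' : List (AddSubgroup A)}
    (hp : l.Perm l') (hl : ∀ P ∈ l, D.IsGrPrime Λ P) : idealProd Λ l = idealProd Λ l' := by
  induction hp with
  | nil => rfl
  | cons P _ ih =>
    rw [idealProd_cons, idealProd_cons, ih fun Q hQ => hl Q (by simp [hQ])]
  | swap P Q l =>
    simp only [idealProd_cons]
    rw [← AddSubgroup.mul_assoc, ← AddSubgroup.mul_assoc,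
      (hl Q (by simp)).mul_comm hΛ (hl P (by simp))]
  | trans h₁ _ ih₁ ih₂ => rw [ih₁ hl, ih₂ fun Q hQ => hl Q (h₁.mem_iff.2 hQ)]

theorem perm_of_idealProd_eq (hΛ : D.IsGrMaximalOrder Λ) {l l' : List (AddSubgroup A)}
    (hl : ∀ P ∈ l, D.IsGrPrime Λ P) (hl' : ∀ P ∈ l', D.IsGrPrime Λ P)
    (h : idealProd Λ l = idealProd Λ l') : l.Perm l' := by
  classical
  have hO := hΛ.prop
  induction l generalizing l' with
  | nil =>
    cases l' with
    | nil => exact List.Perm.nil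
    | cons Q l' =>
      have hQ := hl' Q (by simp)
      have hle : idealProd Λ [] ≤ Q := h ▸ hQ.mul_le_left
        (isTwoSidedGrIdeal_idealProd hO fun P hP => hl' P (by simp [hP])).le
      exact absurd (hle hO.one_mem) hQ.one_notMem
  | cons P l ih =>
    have hP := hl P (by simp)
    have hl₀ : ∀ Q ∈ l, D.IsGrPrime Λ Q := fun Q hQ => hl Q (by simp [hQ])
    have hI := isTwoSidedGrIdeal_idealProd hO hl₀
    have hle : idealProd Λ l' ≤ P := h ▸ hP.mul_le_left hI.le
    -- $P$ occurs in $l'$; commutation moves it to the front, where invertibility cancels it.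
    have hperm := List.perm_cons_erase (hP.mem_of_idealProd_le hO hl' hle)
    have hl₁ : ∀ Q ∈ l'.erase P, D.IsGrPrime Λ Q := fun Q hQ => hl' Q (List.mem_of_mem_erase hQ)
    rw [idealProd_perm hΛ hperm hl', idealProd_cons, idealProd_cons] at h
    have := (hP.isFrac hO).mul_left_cancel hΛ (hI.isFrac hO)
      ((isTwoSidedGrIdeal_idealProd hO hl₁).isFrac hO) h
    exact ((ih hl₀ hl₁ this).cons P).trans hperm.symm

end

end CrystallineGradedRing

theorem mainTheorem11 {R K G A : Type*} [CommRing R] [IsDedekindDomain R]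
    [Field K] [Algebra R K] [IsFractionRing R K]
    [Group G] [Fintype G] [MulSemiringAction G R] [Ring A]
    (D : CrystallineGradedRing R K G A)
    (Λ : AddSubgroup A) (hΛ : D.IsGrMaximalOrder Λ) :
    (∀ M : AddSubgroup A, D.IsTwoSidedGrIdeal Λ M →
      M * latticeInv M = Λ ∧ latticeInv M * M = Λ ∧ latticeInv (latticeInv M) = M) ∧
    (∀ M : AddSubgroup A, D.IsTwoSidedGrIdeal Λ M →
      ∃ l : List (AddSubgroup A), (∀ P ∈ l, D.IsGrPrime Λ P) ∧ idealProd Λ l = M ∧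
        ∀ l' : List (AddSubgroup A), (∀ P ∈ l', D.IsGrPrime Λ P) → idealProd Λ l' = M →
          l'.Perm l) ∧
    (∀ P Q : AddSubgroup A, D.IsGrPrime Λ P → D.IsGrPrime Λ Q → P * Q = Q * P) := by
  refine ⟨fun M hM => ?_, fun M hM => ?_, fun P Q hP hQ => hP.mul_comm hΛ hQ⟩
  · have hF := hM.isFrac hΛ.prop
    exact ⟨hF.mul_latticeInv hΛ, hF.latticeInv_mul hΛ, hF.latticeInv_latticeInv hΛ⟩
  · obtain ⟨l, hl, rfl⟩ := hM.exists_idealProd_eq hΛ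
    exact ⟨l, hl, rfl, fun l' hl' h => CrystallineGradedRing.perm_of_idealProd_eq hΛ hl' hl h⟩
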